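/- Let $A$ be a unital C*-algebra, $\alpha:A\to A$ an injective unital $*$-endomorphism with range $\mathcal R$, $E:A\to\mathcal R$ a conditional expectation (not assumed to be of index-finite type), and $\mathcal L=\alpha^{-1}\circ E$. Let $\mathcal T=\mathcal T(A,\alpha,\mathcal L)$ be the universal unital C*-algebra generated by a copy of $A$ (with the same unit) and an element $\hat S$ subject to $\hat S a=\alpha(a)\hat S$ and $\hat S^*a\hat S=\mathcal L(a)$ for all $a\in A$. Let $h$ be a self-adjoint element of the center of $A$ with $h\ge cI$ for some real $c>1$. Let $\hat\sigma_t$ ($t\in\mathbb R$) be the automorphism of $\mathcal T$ with $\hat\sigma_t(\hat S)=h^{it}\hat S$ and $\hat\sigma_t(a)=a$ for $a\in A$, and let $\hat\gamma_z$ ($z\in S^1$) be the automorphism with $\hat\gamma_z(\hat S)=z\hat S$ and $\hat\gamma_z(a)=a$ for $a\in A$. Let $\hat{\mathcal U}=\{x\in\mathcal T:\hat\gamma_z(x)=x\ \forall z\in S^1\}$. An element $y\in\mathcal T$ is analytic if $t\mapsto\hat\sigma_t(y)$ extends to an entire function $z\mapsto\hat\sigma_z(y)$ from $\mathbb C$ to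 $\mathcal T$. A state $\psi$ of $\mathcal T$ is a ground state if $\sup_{\operatorname{Im}z\ge0}|\psi(x\hat\sigma_z(y))|<\infty$ for all analytic $x,y\in\mathcal T$. Then: 1. The map $\hat P(x)=\int_{S^1}\hat\gamma_z(x)\,dz$ (normalized arc length) is a conditional expectation from $\mathcal T$ onto $\hat{\mathcal U}$. 2. There is exactly one $*$-homomorphism $\pi:\hat{\mathcal U}\to A$ with $\pi(a)=a$ for all $a\in A$ and $\pi(\hat S^n\hat S^{*n})=0$ for all $n>0$. 3. The ground states on $\mathcal T$ are precisely the functionals of the form $\phi\circ\pi\circ\hat P$, where $\phi$ is an arbitrary state of $A$. -/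

import Mathlib

open scoped ENNReal

universe u v

/-! ## Conditional expectations, states, analytic elements and ground states -/

/-- `E : B → B` is a conditional expectation from the unital C⋆-algebra `B` onto its
⋆-subalgebra `C`: a positive linear map with values in `C`, which is the identity on `C` and is
`C`-bimodular. Positive elements of a C⋆-algebra are written in the form `b* b`. -/
structure IsConditionalExpectation {B : Type u} [CStarAlgebra B] (C : StarSubalgebra ℂ B)
    (E : B → B) : Prop where
  map_add : ∀ x y, E (x + y) = E x + E y
  map_smul : ∀ (r : ℂ) (x), E (r • x) = r • E x
  mem : ∀ x, E x ∈ C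
  map_of_mem : ∀ x ∈ C, E x = x
  map_mul_left : ∀ x, ∀ y ∈ C, E (y * x) = y * E x
  map_mul_right : ∀ x, ∀ y ∈ C, E (x * y) = E x * y
  positive : ∀ x, ∃ b, E (star x * x) = star b * b

/-- A state: a positive linear functional taking the value `1` at the unit. -/
structure IsState {B : Type u} [CStarAlgebra B] (ψ : B →ₗ[ℂ] ℂ) : Prop where
  nonneg : ∀ x, ∃ r : ℝ, 0 ≤ r ∧ ψ (star x * x) = r
  map_one : ψ 1 = 1

/-- `f z = σ_z(y)`: the function `f` is an entire extension of the orbit `t ↦ σ_t(y)`. (Such an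
extension is unique if it exists.) -/
structure IsEntireOrbit {B : Type u} [CStarAlgebra B] (σ : ℝ → B →⋆ₐ[ℂ] B) (y : B)
    (f : ℂ → B) : Prop where
  differentiable : Differentiable ℂ f
  apply_ofReal : ∀ t : ℝ, f t = σ t y

/-- `y` is an analytic element for `σ` if `t ↦ σ_t(y)` extends to an entire function. -/
def IsAnalyticElement {B : Type u} [CStarAlgebra B] (σ : ℝ → B →⋆ₐ[ℂ] B) (y : B) : Prop :=
  ∃ f : ℂ → B, IsEntireOrbit σ y f

/-- A ground state for `σ`: a state `ψ` such that `z ↦ ψ (x σ_z(y))` is bounded on the closed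
upper half plane for all analytic elements `x`, `y`. -/
structure IsGroundState {B : Type u} [CStarAlgebra B] (σ : ℝ → B →⋆ₐ[ℂ] B)
    (ψ : B →ₗ[ℂ] ℂ) : Prop where
  isState : IsState ψ
  bounded : ∀ x y : B, IsAnalyticElement σ x → ∀ f : ℂ → B, IsEntireOrbit σ y f →
    ∃ K : ℝ, ∀ z : ℂ, 0 ≤ z.im → ‖ψ (x * f z)‖ ≤ K

/-! ## Two facts about ⋆-homomorphisms -/

theorem starAlgHom_continuous {B : Type u} {C : Type v} [CStarAlgebra B] [CStarAlgebra C]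
    (g : B →⋆ₐ[ℂ] C) : Continuous g :=
  AddMonoidHomClass.continuous_of_bound g 1 fun x => by
    simpa using NonUnitalStarAlgHom.norm_apply_le g x

theorem starAlgHom_intervalIntegral {B : Type u} {C : Type v} [CStarAlgebra B] [CStarAlgebra C]
    (g : B →⋆ₐ[ℂ] C) {F : ℝ → B} (hF : Continuous F) (a b : ℝ) :
    g (∫ t in a..b, F t) = ∫ t in a..b, g (F t) := by
  let g' : B →L[ℂ] C := ⟨g.toAlgHom.toLinearMap, starAlgHom_continuous g⟩
  exact (g'.intervalIntegral_comp_comm (hF.intervalIntegrable _ _)).symm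

/-! ## The Toeplitz algebra -/

/-- A representation of the relations `S a = α(a) S`, `S* a S = L(a)` in a unital
C⋆-algebra `B`. -/
structure ToeplitzPair {A : Type u} [CStarAlgebra A] (α : A →⋆ₐ[ℂ] A) (L : A → A)
    (B : Type v) [CStarAlgebra B] where
  hom : A →⋆ₐ[ℂ] B
  S : B
  S_mul : ∀ a, S * hom a = hom (α a) * S
  star_S_mul_S : ∀ a, star S * hom a * S = hom (L a)

/-- The representations of the relations in the nonzero C⋆-algebras of the universe of `A`. -/
structure ToeplitzRep {A : Type u} [CStarAlgebra A] (α : A →⋆ₐ[ℂ] A) (L : A → A) where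
  carrier : Type u
  [cstar : CStarAlgebra carrier]
  [nontrivial : Nontrivial carrier]
  pair : ToeplitzPair α L carrier

attribute [instance] ToeplitzRep.cstar ToeplitzRep.nontrivial

/-- `Shrink` of a C⋆-algebra, as a C⋆-algebra. -/
noncomputable abbrev shrinkCStar (C : Type v) [CStarAlgebra C] [Small.{u} C] :
    CStarAlgebra (Shrink.{u} C) :=
  letI nr : NormedRing (Shrink.{u} C) := NormedRing.induced (Shrink.{u} C) C
    (Shrink.ringEquiv C) (Shrink.ringEquiv C).injective
  letI na : NormedAlgebra ℂ (Shrink.{u} C) :=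
    NormedAlgebra.induced ℂ (Shrink.{u} C) C (Shrink.algEquiv ℂ C)
  letI sr : StarRing (Shrink.{u} C) :=
    { star := fun x => (Shrink.ringEquiv C).symm (star (Shrink.ringEquiv C x))
      star_involutive := fun x => by simp
      star_mul := fun x y => by simp
      star_add := fun x y => by simp }
  { toNormedRing := nr
    toStarRing := sr
    toNormedAlgebra := na
    toCompleteSpace := by
      have hi : Isometry (Shrink.ringEquiv.{u} C) := AddMonoidHomClass.isometry_of_norm _ fun _ => rfl
      exact (hi.isUniformInducing.completeSpace_congr (Shrink.ringEquiv C).surjective).2 inferInstance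
    toCStarRing := ⟨fun x => by
      change ‖Shrink.ringEquiv C x‖ * ‖Shrink.ringEquiv C x‖ ≤
        ‖Shrink.ringEquiv C ((Shrink.ringEquiv C).symm (star (Shrink.ringEquiv C x)) * x)‖
      simp [CStarRing.norm_star_mul_self]⟩
    toStarModule := ⟨fun r x => by
      change (Shrink.algEquiv ℂ C).symm (star (Shrink.algEquiv ℂ C (r • x))) =
        star r • (Shrink.algEquiv ℂ C).symm (star (Shrink.algEquiv ℂ C x))
      rw [map_smul, star_smul, map_smul]⟩ }

/-- A C⋆-algebra whose underlying set is small is isomorphic to one in the smaller universe. -/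
theorem exists_shrink_starAlgEquiv (C : Type v) [CStarAlgebra C] [Small.{u} C] :
    ∃ (D : Type u) (_ : CStarAlgebra D), Nonempty (D ≃⋆ₐ[ℂ] C) :=
  letI := shrinkCStar.{u} C
  ⟨Shrink.{u} C, shrinkCStar C, ⟨
    { Shrink.ringEquiv.{u} C with
      map_star' := fun _ => (Shrink.ringEquiv C).apply_symm_apply _
      map_smul' := fun r x => map_smul (Shrink.algEquiv ℂ C) r x }⟩⟩

noncomputable section

namespace Toeplitz

section Construction

variable {A : Type u} [CStarAlgebra A] (α : A →⋆ₐ[ℂ] A) (L : A → A)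

/-- The `ℓ^∞`-product of all representations. -/
abbrev RepProd : Type (u + 1) := lp (fun r : ToeplitzRep α L => r.carrier) ∞

instance : CStarAlgebra (RepProd α L) where
  toNormedRing := lp.inftyNormedRing
  toStarRing := lp.inftyStarRing
  toCompleteSpace := inferInstance
  toCStarRing := inferInstance
  toNormedAlgebra := lp.inftyNormedAlgebra
  toStarModule := inferInstance

/-- The direct sum of all representations, restricted to `A`. -/
def prodHom : A →⋆ₐ[ℂ] RepProd α L where
  toFun a := ⟨fun r => r.pair.hom a, memℓp_infty ⟨‖a‖, by
    rintro _ ⟨r, rfl⟩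
    exact NonUnitalStarAlgHom.norm_apply_le r.pair.hom a⟩⟩
  map_one' := by ext r; simp
  map_mul' a b := by ext r; simp
  map_zero' := by ext r; simp
  map_add' a b := by ext r; simp; rfl
  commutes' c := by
    ext r
    exact r.pair.hom.toAlgHom.commutes c
  map_star' a := by ext r; exact map_star r.pair.hom a

/-- The direct sum of the elements `S` of all representations. -/
def prodS : RepProd α L :=
  ⟨fun r => r.pair.S, memℓp_infty ⟨max 1 ‖L 1‖, by
    rintro _ ⟨r, rfl⟩
    have h1 : ‖r.pair.S‖ * ‖r.pair.S‖ ≤ ‖L 1‖ := by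
      rw [← CStarRing.norm_star_mul_self]
      have := r.pair.star_S_mul_S 1
      rw [map_one, mul_one] at this
      rw [this]
      exact NonUnitalStarAlgHom.norm_apply_le r.pair.hom _
    by_contra hcon
    rw [not_le, max_lt_iff] at hcon
    nlinarith [hcon.1, hcon.2]⟩⟩

end Construction

end Toeplitz

/-- The Toeplitz algebra `T(A, α, L)`: the universal unital C⋆-algebra generated by a copy of `A`
and an element `S` subject to the relations `S a = α(a) S` and `S* a S = L(a)`. It is realized as
the C⋆-algebra generated by the direct sum of all representations of these relations in the
universe of `A`; `Toeplitz.existsUnique_lift` is its universal property with respect to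
representations in arbitrary C⋆-algebras, of any universe. -/
def Toeplitz {A : Type u} [CStarAlgebra A] (α : A →⋆ₐ[ℂ] A) (L : A → A) : Type (u + 1) :=
  ↥(StarAlgebra.adjoin ℂ (Set.range (Toeplitz.prodHom α L) ∪
    {Toeplitz.prodS α L})).topologicalClosure

namespace Toeplitz

section API

variable {A : Type u} [CStarAlgebra A] (α : A →⋆ₐ[ℂ] A) (L : A → A)

instance : CStarAlgebra (Toeplitz α L) :=
  StarSubalgebra.cstarAlgebra _ (h_closed := StarSubalgebra.isClosed_topologicalClosure
    (StarAlgebra.adjoin ℂ (Set.range (prodHom α L) ∪ {prodS α L})))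

/-- The inclusion `T(A, α, L) → ∏ B`. -/
def incl : Toeplitz α L →⋆ₐ[ℂ] RepProd α L :=
  (StarAlgebra.adjoin ℂ (Set.range (prodHom α L) ∪ {prodS α L})).topologicalClosure.subtype

/-- The canonical map `A → T(A, α, L)`. -/
def ι : A →⋆ₐ[ℂ] Toeplitz α L :=
  (prodHom α L).codRestrict _ fun a => StarSubalgebra.le_topologicalClosure _
    (StarAlgebra.subset_adjoin ℂ _ (Or.inl ⟨a, rfl⟩))

/-- The canonical isometry `Ŝ ∈ T(A, α, L)`. -/
def S : Toeplitz α L :=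
  ⟨prodS α L, StarSubalgebra.le_topologicalClosure _ (StarAlgebra.subset_adjoin ℂ _ (Or.inr rfl))⟩

theorem S_mul (a : A) : S α L * ι α L a = ι α L (α a) * S α L := by
  apply Subtype.ext
  change prodS α L * prodHom α L a = prodHom α L (α a) * prodS α L
  ext r
  exact r.pair.S_mul a

theorem star_S_mul_S (a : A) : star (S α L) * ι α L a * S α L = ι α L (L a) := by
  apply Subtype.ext
  change star (prodS α L) * prodHom α L a * prodS α L = prodHom α L (L a)
  ext r
  exact r.pair.star_S_mul_S a

/-- A closed ⋆-subalgebra which contains `A` and `Ŝ` is everything. -/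
theorem closed_induction (P : StarSubalgebra ℂ (Toeplitz α L))
    (hP : IsClosed (P : Set (Toeplitz α L))) (hι : ∀ a, ι α L a ∈ P) (hS : S α L ∈ P)
    (x : Toeplitz α L) : x ∈ P := by
  have hcl : IsClosed ((fun x : Toeplitz α L => incl α L x) '' (P : Set (Toeplitz α L))) := by
    refine (Topology.IsClosedEmbedding.isClosedMap ?_) _ hP
    exact (StarSubalgebra.isClosed_topologicalClosure _).isClosedEmbedding_subtypeVal
  have hle : (StarAlgebra.adjoin ℂ (Set.range (prodHom α L) ∪
      {prodS α L})).topologicalClosure ≤ P.map (incl α L) := by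
    refine StarSubalgebra.topologicalClosure_minimal (StarAlgebra.adjoin_le ?_) hcl
    rintro y (⟨a, rfl⟩ | rfl)
    · exact ⟨ι α L a, hι a, rfl⟩
    · exact ⟨S α L, hS, rfl⟩
  obtain ⟨y, hy, hyx⟩ := hle x.2
  have : y = x := Subtype.ext hyx
  exact this ▸ hy

theorem hom_ext {B : Type v} [CStarAlgebra B] {f g : Toeplitz α L →⋆ₐ[ℂ] B}
    (hι : ∀ a, f (ι α L a) = g (ι α L a)) (hS : f (S α L) = g (S α L)) : f = g := by
  ext x
  exact closed_induction α L (StarAlgHom.equalizer f g) 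
    (isClosed_eq (starAlgHom_continuous f) (starAlgHom_continuous g)) hι hS x

variable {α L}

theorem small_generated {B : Type v} [CStarAlgebra B] (p : ToeplitzPair α L B) :
    Small.{u} (StarAlgebra.adjoin ℂ (Set.range p.hom ∪ {p.S})).topologicalClosure := by
  let g : A ⊕ Bool → B := Sum.elim p.hom fun b => if b then p.S else star p.S
  let F : FreeAlgebra ℂ (A ⊕ Bool) →ₐ[ℂ] B := FreeAlgebra.lift ℂ g
  have hF : ∀ x ∈ StarAlgebra.adjoin ℂ (Set.range p.hom ∪ {p.S}), x ∈ F.range := by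
    intro x hx
    have hx' : x ∈ Algebra.adjoin ℂ ((Set.range p.hom ∪ {p.S}) ∪
      star (Set.range p.hom ∪ {p.S})) := hx
    refine (Algebra.adjoin_le (S := F.range) ?_) hx'
    have hgen : ∀ i, g i ∈ F.range := fun i => ⟨FreeAlgebra.ι ℂ i, by simp [F]⟩
    rintro y ((⟨a, rfl⟩ | rfl) | hy)
    · exact hgen (Sum.inl a)
    · exact hgen (Sum.inr true)
    · rcases hy with ⟨a, ha⟩ | hy
      · have : y = g (Sum.inl (star a)) := by
          simp [g, map_star, ha]
        exact this ▸ hgen _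
      · have : y = g (Sum.inr false) := by
          have hy' : star y = p.S := hy
          simp [g, ← hy']
        exact this ▸ hgen _
  let lim : (ℕ → FreeAlgebra ℂ (A ⊕ Bool)) → B := fun x =>
    Filter.limUnder Filter.atTop fun n => F (x n)
  have hsub : ((StarAlgebra.adjoin ℂ (Set.range p.hom ∪ {p.S})).topologicalClosure : Set B) ⊆
      Set.range lim := by
    intro x hx
    obtain ⟨s, hs, hlim⟩ := mem_closure_iff_seq_limit.1 hx
    choose w hw using fun n => hF (s n) (hs n)
    refine ⟨w, ?_⟩
    have hwl : Filter.Tendsto (fun n => F (w n)) Filter.atTop (nhds x) :=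
      hlim.congr fun n => (hw n).symm
    exact hwl.limUnder_eq
  exact small_subset hsub

/-- The universal property of `T(A, α, L)`. -/
theorem existsUnique_lift {B : Type v} [CStarAlgebra B] (p : ToeplitzPair α L B) :
    ∃! f : Toeplitz α L →⋆ₐ[ℂ] B, (∀ a, f (ι α L a) = p.hom a) ∧ f (S α L) = p.S := by
  refine existsUnique_of_exists_of_unique ?_ fun f g hf hg =>
    hom_ext α L (fun a => (hf.1 a).trans (hg.1 a).symm) (hf.2.trans hg.2.symm)
  rcases subsingleton_or_nontrivial B with hB | hB
  · let f : Toeplitz α L →⋆ₐ[ℂ] B :=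
      { toFun := fun _ => 0
        map_one' := Subsingleton.elim _ _
        map_mul' := fun _ _ => Subsingleton.elim _ _
        map_zero' := Subsingleton.elim _ _
        map_add' := fun _ _ => Subsingleton.elim _ _
        commutes' := fun _ => Subsingleton.elim _ _
        map_star' := fun _ => Subsingleton.elim _ _ }
    exact ⟨f, fun _ => Subsingleton.elim _ _, Subsingleton.elim _ _⟩
  · let G := StarAlgebra.adjoin ℂ (Set.range p.hom ∪ {p.S})
    let _ : CStarAlgebra G.topologicalClosure :=
      StarSubalgebra.cstarAlgebra _ (h_closed := G.isClosed_topologicalClosure)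
    have : Small.{u} G.topologicalClosure := small_generated p
    obtain ⟨D, hD, ⟨e⟩⟩ := exists_shrink_starAlgEquiv.{u} G.topologicalClosure
    let g : D →⋆ₐ[ℂ] B := G.topologicalClosure.subtype.comp (e : D →⋆ₐ[ℂ] G.topologicalClosure)
    have hg : Function.Injective g := Subtype.val_injective.comp e.injective
    have hge : ∀ x, g (e.symm x) = x := fun x => congrArg Subtype.val (e.apply_symm_apply x)
    have hmem : ∀ a, p.hom a ∈ G.topologicalClosure := fun a =>
      StarSubalgebra.le_topologicalClosure _ (StarAlgebra.subset_adjoin ℂ _ (Or.inl ⟨a, rfl⟩))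
    have hS : p.S ∈ G.topologicalClosure :=
      StarSubalgebra.le_topologicalClosure _ (StarAlgebra.subset_adjoin ℂ _ (Or.inr rfl))
    have : Nontrivial D := ⟨⟨1, 0, fun h => one_ne_zero (α := B) (by
      rw [← map_one g, h, map_zero])⟩⟩
    let q : ToeplitzPair α L D :=
      { hom := (e.symm : G.topologicalClosure →⋆ₐ[ℂ] D).comp (p.hom.codRestrict _ hmem)
        S := e.symm ⟨p.S, hS⟩
        S_mul := fun a => hg (by
          rw [map_mul, map_mul]
          exact (congrArg₂ (· * ·) (hge ⟨p.S, hS⟩) (hge ⟨p.hom a, hmem a⟩)).trans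
            ((p.S_mul a).trans (congrArg₂ (· * ·) (hge ⟨p.hom (α a), hmem (α a)⟩)
              (hge ⟨p.S, hS⟩)).symm))
        star_S_mul_S := fun a => hg (by
          rw [map_mul, map_mul, map_star]
          exact (congrArg₂ (· * ·) (congrArg₂ (· * ·) (congrArg star (hge ⟨p.S, hS⟩))
            (hge ⟨p.hom a, hmem a⟩)) (hge ⟨p.S, hS⟩)).trans
              ((p.star_S_mul_S a).trans (hge ⟨p.hom (L a), hmem (L a)⟩).symm)) }
    let r : ToeplitzRep α L := { carrier := D, pair := q }
    let ev : RepProd α L →⋆ₐ[ℂ] D :=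
      { toFun := fun x => x r
        map_one' := rfl
        map_mul' := fun _ _ => rfl
        map_zero' := rfl
        map_add' := fun _ _ => rfl
        commutes' := fun _ => rfl
        map_star' := fun _ => rfl }
    exact ⟨g.comp (ev.comp (incl α L)), fun a => hge ⟨p.hom a, hmem a⟩, hge ⟨p.S, hS⟩⟩

/-- The ⋆-homomorphism `T(A, α, L) → B` given by the universal property. -/
def lift {B : Type v} [CStarAlgebra B] (p : ToeplitzPair α L B) : Toeplitz α L →⋆ₐ[ℂ] B :=
  (existsUnique_lift p).choose

theorem lift_ι {B : Type v} [CStarAlgebra B] (p : ToeplitzPair α L B) (a : A) :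
    lift p (ι α L a) = p.hom a :=
  (existsUnique_lift p).choose_spec.1.1 a

theorem lift_S {B : Type v} [CStarAlgebra B] (p : ToeplitzPair α L B) :
    lift p (S α L) = p.S :=
  (existsUnique_lift p).choose_spec.1.2

/-! ### Gauge automorphisms -/

variable (α L)

/-- For a unitary `u` in the center of `A`, the ⋆-automorphism `σ̂_u` of `T(A, α, L)` with
`σ̂_u(Ŝ) = u Ŝ` and `σ̂_u(a) = a` for `a ∈ A`. -/
def sigma (u : A) (hu : u ∈ unitary A) (hc : u ∈ Set.center A) :
    Toeplitz α L →⋆ₐ[ℂ] Toeplitz α L :=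
  lift
    { hom := ι α L
      S := ι α L u * S α L
      S_mul := fun a => by
        rw [mul_assoc, S_mul, ← mul_assoc, ← mul_assoc, ← map_mul, ← map_mul, hc.comm (α a)]
      star_S_mul_S := fun a => by
        have h : star u * a * u = a := by
          rw [mul_assoc, ← hc.comm a, ← mul_assoc, Unitary.star_mul_self_of_mem hu, one_mul]
        rw [star_mul, ← map_star]
        calc star (S α L) * ι α L (star u) * ι α L a * (ι α L u * S α L)
            = star (S α L) * ι α L (star u * a * u) * S α L := by
              simp only [map_mul, mul_assoc]
          _ = _ := by rw [h, star_S_mul_S] }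

theorem sigma_ι (u : A) (hu : u ∈ unitary A) (hc : u ∈ Set.center A) (a : A) :
    sigma α L u hu hc (ι α L a) = ι α L a := lift_ι _ a

theorem sigma_S (u : A) (hu : u ∈ unitary A) (hc : u ∈ Set.center A) :
    sigma α L u hu hc (S α L) = ι α L u * S α L := lift_S _

end API

section Gauge

variable {A : Type u} [CStarAlgebra A]

/-- The power `h^{it} = exp (i t log h)`, for `h` self-adjoint with `h ≥ c 1` for some `c > 0`. -/
def ipow (h : A) (t : ℝ) : A :=
  NormedSpace.exp ((Complex.I * (t : ℂ)) • CFC.log h)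

theorem ipow_mem_unitary (h : A) (t : ℝ) : ipow h t ∈ unitary A := by
  have hs : IsSelfAdjoint (t • CFC.log h) := (IsSelfAdjoint.all t).smul IsSelfAdjoint.log
  have := (selfAdjoint.expUnitary (⟨t • CFC.log h, hs⟩ : selfAdjoint A)).2
  simpa [ipow, selfAdjoint.expUnitary_coe, mul_smul] using this

theorem ipow_mem_center {h : A} (hc : h ∈ Set.center A) (t : ℝ) :
    ipow h t ∈ Set.center A := by
  rw [Semigroup.mem_center_iff]
  intro b
  have h1 : Commute h b := hc.comm b
  exact ((h1.cfc_real Real.log).smul_left (Complex.I * (t : ℂ))).exp_left.eq.symm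

variable (α : A →⋆ₐ[ℂ] A) (L : A → A)

/-- The gauge action associated to `h`: the one-parameter group `σ̂^h_t = σ̂_{h^{it}}`. -/
def gauge {h : A} (hc : h ∈ Set.center A) (t : ℝ) : Toeplitz α L →⋆ₐ[ℂ] Toeplitz α L :=
  sigma α L (ipow h t) (ipow_mem_unitary h t) (ipow_mem_center hc t)

/-- The scalar gauge action `γ̂` of the circle: `γ̂_z(Ŝ) = z Ŝ`, and `γ̂_z(a) = a` for `a ∈ A`. -/
def circleGauge (z : Circle) : Toeplitz α L →⋆ₐ[ℂ] Toeplitz α L :=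
  sigma α L (algebraMap ℂ A z)
    (by
      rw [Unitary.mem_iff, ← algebraMap_star_comm, ← map_mul, ← map_mul]
      have h1 : (star (z : ℂ)) * z = 1 := by
        rw [Complex.star_def, ← Circle.coe_inv_eq_conj, ← Circle.coe_mul]; simp
      rw [mul_comm (z : ℂ), h1]; simp)
    (by
      rw [Semigroup.mem_center_iff]
      exact fun b => (Algebra.commutes (z : ℂ) b).symm)

theorem circleGauge_ι (z : Circle) (a : A) : circleGauge α L z (ι α L a) = ι α L a :=
  sigma_ι ..

theorem circleGauge_S (z : Circle) : circleGauge α L z (S α L) = (z : ℂ) • S α L := by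
  rw [circleGauge, sigma_S, Algebra.smul_def]
  congr 1
  exact (ι α L).toAlgHom.commutes _

theorem circleGauge_mul (w z : Circle) (x : Toeplitz α L) :
    circleGauge α L w (circleGauge α L z x) = circleGauge α L (w * z) x := by
  have : (circleGauge α L w).comp (circleGauge α L z) = circleGauge α L (w * z) := by
    refine hom_ext α L (fun a => ?_) ?_
    · simp [circleGauge_ι]
    · simp [circleGauge_S, map_smul, smul_smul, mul_comm]
  exact congrArg (fun f => f x) this

/-- The gauge-fixed algebra `Û`: the fixed points of `γ̂`. -/
def fixed : StarSubalgebra ℂ (Toeplitz α L) where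
  carrier := {x | ∀ z, circleGauge α L z x = x}
  mul_mem' hx hy z := by rw [map_mul, hx z, hy z]
  add_mem' hx hy z := by rw [map_add, hx z, hy z]
  algebraMap_mem' c z := (circleGauge α L z).toAlgHom.commutes c
  star_mem' hx z := by rw [map_star, hx z]

theorem ι_mem_fixed (a : A) : ι α L a ∈ fixed α L := fun z => circleGauge_ι α L z a

theorem S_pow_mem_fixed (n : ℕ) : S α L ^ n * star (S α L) ^ n ∈ fixed α L := fun z => by
  rw [map_mul, map_pow, map_pow, map_star, circleGauge_S, star_smul, smul_pow, smul_pow,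
    smul_mul_smul_comm, ← mul_pow]
  have h1 : (z : ℂ) * star (z : ℂ) = 1 := by
    rw [Complex.star_def, ← Circle.coe_inv_eq_conj, ← Circle.coe_mul]; simp
  rw [h1, one_pow, one_smul]

/-- Strong continuity of the scalar gauge action. -/
theorem continuous_circleGauge (x : Toeplitz α L) :
    Continuous fun z : Circle => circleGauge α L z x := by
  let P : StarSubalgebra ℂ (Toeplitz α L) :=
    { carrier := {x | Continuous fun z : Circle => circleGauge α L z x}
      mul_mem' := fun hx hy => by
        simp only [Set.mem_ofPred_eq, map_mul] at hx hy ⊢; exact hx.mul hy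
      add_mem' := fun hx hy => by
        simp only [Set.mem_ofPred_eq, map_add] at hx hy ⊢; exact hx.add hy
      algebraMap_mem' := fun c => by
        have : ∀ z, circleGauge α L z (algebraMap ℂ _ c) = algebraMap ℂ _ c :=
          fun z => (circleGauge α L z).toAlgHom.commutes c
        simp only [Set.mem_ofPred_eq, this]; exact continuous_const
      star_mem' := fun hx => by
        simp only [Set.mem_ofPred_eq, map_star] at hx ⊢; exact hx.star }
  refine closed_induction α L P ?_ (fun a => ?_) ?_ x
  · refine isClosed_of_closure_subset fun y hy => ?_
    change Continuous fun z : Circle => circleGauge α L z y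
    refine continuous_of_uniform_approx_of_continuous fun U hU => ?_
    obtain ⟨ε, hε, hεU⟩ := Metric.mem_uniformity_dist.1 hU
    obtain ⟨w, hw, hyw⟩ := Metric.mem_closure_iff.1 hy ε hε
    refine ⟨fun z => circleGauge α L z w, hw, fun z => hεU ?_⟩
    rw [dist_eq_norm, ← map_sub]
    refine lt_of_le_of_lt (NonUnitalStarAlgHom.norm_apply_le _ _) ?_
    rwa [← dist_eq_norm]
  · change Continuous fun z : Circle => circleGauge α L z (ι α L a)
    simp only [circleGauge_ι]; exact continuous_const
  · change Continuous fun z : Circle => circleGauge α L z (S α L)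
    simp only [circleGauge_S]
    exact (continuous_subtype_val.comp continuous_id).smul continuous_const

/-- `P̂(x) = ∫_{S¹} γ̂_z(x) dz`, with respect to normalized arc length. -/
def circleMean (x : Toeplitz α L) : Toeplitz α L :=
  (2 * Real.pi)⁻¹ • ∫ t in (0 : ℝ)..(2 * Real.pi), circleGauge α L (Circle.exp t) x

theorem circleMean_mem_fixed (x : Toeplitz α L) : circleMean α L x ∈ fixed α L := by
  intro w
  obtain ⟨s, rfl⟩ := Circle.exp_surjective w
  have hcont : Continuous fun t : ℝ => circleGauge α L (Circle.exp t) x :=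
    (continuous_circleGauge α L x).comp Circle.exp.continuous
  have hsmul : ∀ (r : ℝ) (y : Toeplitz α L), circleGauge α L (Circle.exp s) (r • y) =
      r • circleGauge α L (Circle.exp s) y := fun r y => by
    rw [← Complex.coe_smul, map_smul, Complex.coe_smul]
  rw [circleMean, hsmul, starAlgHom_intervalIntegral _ hcont]
  congr 1
  have h1 : ∀ t : ℝ, circleGauge α L (Circle.exp s) (circleGauge α L (Circle.exp t) x) =
      circleGauge α L (Circle.exp (t + s)) x := fun t => by
    rw [add_comm, Circle.exp_add, ← circleGauge_mul]
  simp only [h1]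
  rw [intervalIntegral.integral_comp_add_right (fun t => circleGauge α L (Circle.exp t) x)]
  have hper : Function.Periodic (fun t : ℝ => circleGauge α L (Circle.exp t) x)
      (2 * Real.pi) := fun t => by simp
  rw [zero_add, add_comm (2 * Real.pi) s, hper.intervalIntegral_add_eq s 0, zero_add]

/-- `P̂` as a map onto `Û`. -/
def expectation (x : Toeplitz α L) : fixed α L := ⟨circleMean α L x, circleMean_mem_fixed α L x⟩

/-- `π : Û → A` is a ⋆-homomorphism with `π(a) = a` for `a ∈ A`, and `π(Ŝⁿ Ŝ*ⁿ) = 0` for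
`n > 0`. -/
structure IsVacuumHom (π : fixed α L →⋆ₐ[ℂ] A) : Prop where
  map_ι : ∀ a, π ⟨ι α L a, ι_mem_fixed α L a⟩ = a
  map_S : ∀ n : ℕ, 0 < n → π ⟨S α L ^ n * star (S α L) ^ n, S_pow_mem_fixed α L n⟩ = 0

end Gauge

end Toeplitz

/-- The transfer operator `L = α⁻¹ ∘ E`, for `α` injective and `E` with values in the range
of `α`. -/
def transferOperator {A : Type u} [CStarAlgebra A] (α : A →⋆ₐ[ℂ] A) (E : A → A) : A → A :=
  fun a => Function.invFun α (E a)

end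

/-! The monomials a Ŝⁿ Ŝ*ᵐ b span a dense ⋆-subalgebra, since Ŝ*ᵐ a Ŝᵐ = Lᵐ(a) collapses the middle
of a product. The circle mean averages automorphisms, hence is a conditional expectation; it fixes
the monomials with n = m and kills the others.

The pivot is the notion of a vacuum state (`IsVacuumState`): one for which Ŝ* annihilates the GNS
vectors of A. By Cauchy–Schwarz it vanishes on every monomial with n > 0 or m > 0, so it is
determined by its restriction to A (`IsVacuumState.ext`). For π as in the second claim, φ ∘ π ∘ P̂
is a vacuum state extending φ, so these functionals are exactly the vacuum states. Since states
separate the points of A, the same determinacy makes π unique.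

For the existence of π, each state φ of A yields a Fock space in which Ŝ* kills the vacuum vectors.
An element of Û acts on the vacuum vectors of all these spaces as left multiplication by one element
of A (`Toeplitz.exists_actsAs`), and that element is its image under π. The estimate
`ActsAs.norm_le` carries this from monomials to limits.

Ground states are vacuum states because σ̂_z(Ŝ*) = Ŝ* h^{-iz} decays as Im z → -∞, by h ≥ c > 1: the
function z ↦ ψ((Ŝ*b)* σ̂_z(Ŝ*b)) is then bounded on ℂ, so it is constant by Liouville, and the
constant is 0. Conversely, in a vacuum state the monomials with m > 0 contribute nothing and the
others have orbits bounded on the upper half plane. Approximating an analytic y by w in the monomial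
span controls σ̂_z(y) - σ̂_z(w) only for real z; Phragmén–Lindelöf and the three lines theorem carry
the bound into the half plane (`IsState.exists_bound_of_dense`). -/

/-! ### States: Cauchy–Schwarz, norm characterization, separation of points -/

section States

open scoped ComplexOrder InnerProductSpace

variable {B : Type u} [CStarAlgebra B]

theorem IsState.apply_nonneg [PartialOrder B] [StarOrderedRing B] {ψ : B →ₗ[ℂ] ℂ}
    (hψ : IsState ψ) {p : B} (hp : 0 ≤ p) : 0 ≤ ψ p := by
  obtain ⟨x, rfl⟩ := CStarAlgebra.nonneg_iff_eq_star_mul_self.1 hp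
  obtain ⟨r, hr, h⟩ := hψ.nonneg x
  rw [h]
  exact_mod_cast hr

/-- A state as a positive linear functional. -/
noncomputable def IsState.toPositive [PartialOrder B] [StarOrderedRing B] {ψ : B →ₗ[ℂ] ℂ}
    (hψ : IsState ψ) : B →ₚ[ℂ] ℂ :=
  PositiveLinearMap.mk₀ ψ fun _ hx => hψ.apply_nonneg hx

/-- The Cauchy–Schwarz inequality for states. -/
theorem IsState.norm_apply_star_mul_le {ψ : B →ₗ[ℂ] ℂ} (hψ : IsState ψ) (x y : B) :
    ‖ψ (star x * y)‖ ≤ √(ψ (star x * x)).re * √(ψ (star y * y)).re := by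
  let _ := CStarAlgebra.spectralOrder B
  let _ := CStarAlgebra.spectralOrderedRing B
  exact norm_inner_le_norm (𝕜 := ℂ) (hψ.toPositive.toPreGNS x) (hψ.toPositive.toPreGNS y)

theorem IsState.map_star {ψ : B →ₗ[ℂ] ℂ} (hψ : IsState ψ) (x : B) : ψ (star x) = star (ψ x) := by
  let _ := CStarAlgebra.spectralOrder B
  let _ := CStarAlgebra.spectralOrderedRing B
  exact StarHomClass.map_star hψ.toPositive x

theorem IsState.norm_apply_le {ψ : B →ₗ[ℂ] ℂ} (hψ : IsState ψ) (x : B) : ‖ψ x‖ ≤ ‖x‖ := by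
  let _ := CStarAlgebra.spectralOrder B
  let _ := CStarAlgebra.spectralOrderedRing B
  have h1 : (ψ (star x * x)).re ≤ ‖x‖ ^ 2 := by
    have h2 : star x * x ≤ algebraMap ℝ B (‖x‖ ^ 2) := CStarAlgebra.star_mul_le_algebraMap_norm_sq
    have h3 := hψ.apply_nonneg (sub_nonneg.2 h2)
    rw [map_sub, Algebra.algebraMap_eq_smul_one, ← Complex.coe_smul, map_smul, hψ.map_one] at h3
    have := (Complex.nonneg_iff.1 h3).1
    simpa [← Complex.ofReal_pow] using this
  have h4 := hψ.norm_apply_star_mul_le 1 x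
  simp only [star_one, one_mul, hψ.map_one, Complex.one_re, Real.sqrt_one] at h4
  exact h4.trans (Real.sqrt_le_iff.2 ⟨norm_nonneg _, h1⟩)

theorem IsState.continuous {ψ : B →ₗ[ℂ] ℂ} (hψ : IsState ψ) : Continuous ψ :=
  AddMonoidHomClass.continuous_of_bound ψ 1 fun x => by simpa using hψ.norm_apply_le x

/-- A hermitian functional of norm at most one which is `1` at the unit is a state. -/
theorem isState_of_norm_le {ψ : B →ₗ[ℂ] ℂ} (h1 : ψ 1 = 1) (hle : ∀ x, ‖ψ x‖ ≤ ‖x‖)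
    (hstar : ∀ x, ψ (star x) = star (ψ x)) : IsState ψ := by
  let _ := CStarAlgebra.spectralOrder B
  let _ := CStarAlgebra.spectralOrderedRing B
  refine ⟨fun x => ⟨(ψ (star x * x)).re, ?_, ?_⟩, h1⟩
  · set p := star x * x with hp
    have hp0 : 0 ≤ p := star_mul_self_nonneg x
    have hp1 : p ≤ algebraMap ℝ B ‖p‖ := (IsSelfAdjoint.of_nonneg hp0).le_algebraMap_norm_self
    -- Applying ψ to ‖p‖ - p, whose norm is at most ‖p‖, gives ‖p‖ - Re ψ(p) ≤ ‖p‖, so Re ψ(p) ≥ 0.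
    have h2 : ‖algebraMap ℝ B ‖p‖ - p‖ ≤ ‖p‖ := by
      rw [CStarAlgebra.norm_le_iff_le_algebraMap _ (norm_nonneg p) (sub_nonneg.2 hp1)]
      exact sub_le_self _ hp0
    have h3 := (hle _).trans h2
    rw [map_sub, Algebra.algebraMap_eq_smul_one, ← Complex.coe_smul, map_smul, h1] at h3
    have h4 := (Complex.re_le_norm _).trans h3
    simp at h4
    linarith
  · have h2 : star (ψ (star x * x)) = ψ (star x * x) := by rw [← hstar]; simp
    exact (Complex.conj_eq_iff_re.1 h2).symm

/-- Every positive element is normed by a state. -/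
theorem exists_isState_apply_eq_norm [Nontrivial B] (x : B) :
    ∃ φ : B →ₗ[ℂ] ℂ, IsState φ ∧ φ (star x * x) = ‖star x * x‖ := by
  let _ := CStarAlgebra.spectralOrder B
  let _ := CStarAlgebra.spectralOrderedRing B
  set p := star x * x with hp
  have hp0 : 0 ≤ p := star_mul_self_nonneg x
  -- A norm-one functional attaining the norm of 1 + p must attain those of 1 and p separately,
  -- since ‖1 + p‖ = 1 + ‖p‖.
  have hnorm : 1 + ‖p‖ ≤ ‖1 + p‖ := by
    have hmem : ‖p‖ ∈ spectrum ℝ p := CStarAlgebra.norm_mem_spectrum_of_nonneg hp0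
    have h1 : ‖p‖ + 1 ∈ spectrum ℝ (algebraMap ℝ B 1 + p) := spectrum.add_mem_add_iff.2 hmem
    have h2 := spectrum.norm_le_norm_of_mem h1
    rw [map_one, Real.norm_of_nonneg (by positivity)] at h2
    linarith
  obtain ⟨g, hg, hgp⟩ := exists_dual_vector'' ℂ (1 + p)
  have hgle : ∀ y, ‖g y‖ ≤ ‖y‖ := fun y =>
    (g.le_opNorm y).trans (mul_le_of_le_one_left (norm_nonneg _) hg)
  have hre : ∀ y, (g y).re ≤ ‖y‖ := fun y => (Complex.re_le_norm _).trans (hgle y)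
  have hsum : (g 1).re + (g p).re = ‖1 + p‖ := by
    have := congrArg Complex.re hgp
    simpa [map_add] using this
  have hone : (g 1).re = 1 := by
    have := hre 1; have := hre p; rw [norm_one] at *; linarith
  have hgp' : (g p).re = ‖p‖ := by
    have := hre 1; have := hre p; rw [norm_one] at *; linarith
  -- The hermitian part of g: it keeps the real parts of g on self-adjoint elements and does not
  -- increase the norm bound.
  let φ : B →ₗ[ℂ] ℂ :=
    { toFun := fun y => (g y + star (g (star y))) / 2
      map_add' := fun y z => by simp only [star_add, map_add]; ring
      map_smul' := fun r y => by
        simp only [star_smul, map_smul, smul_eq_mul, star_mul', star_star, RingHom.id_apply]; ring }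
  have hsa : ∀ y, star y = y → φ y = (g y).re := fun y hy => by
    change (g y + star (g (star y))) / 2 = _
    rw [hy, Complex.star_def, Complex.add_conj]; simp
  refine ⟨φ, isState_of_norm_le ?_ (fun y => ?_) fun y => ?_, ?_⟩
  · rw [hsa 1 (star_one B), hone]; simp
  · change ‖(g y + star (g (star y))) / 2‖ ≤ _
    rw [norm_div, Complex.norm_ofNat, div_le_iff₀ two_pos]
    refine (norm_add_le _ _).trans ?_
    have := hgle y; have := hgle (star y)
    rw [norm_star] at *
    linarith
  · change (g (star y) + star (g (star (star y)))) / 2 = star ((g y + star (g (star y))) / 2)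
    simp only [star_star, star_div₀, star_add, star_ofNat]
    rw [add_comm]
  · rw [hsa p (IsSelfAdjoint.of_nonneg hp0), hgp']

/-- States separate the points of a C⋆-algebra. -/
theorem eq_zero_of_forall_isState {x : B}
    (h : ∀ φ : B →ₗ[ℂ] ℂ, IsState φ → φ (star x * x) = 0) : x = 0 := by
  nontriviality B
  obtain ⟨φ, hφ, hx⟩ := exists_isState_apply_eq_norm x
  rw [h φ hφ, eq_comm, Complex.ofReal_eq_zero, norm_eq_zero] at hx
  exact CStarRing.star_mul_self_eq_zero_iff x |>.1 hx

end States

/-! ### Transfer operators and the states φ ∘ Lⁿ -/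

noncomputable section TransferOperator

/-- The algebraic properties of a transfer operator for `α` which is normalized and positive. -/
structure IsTransferOperator {A : Type u} [CStarAlgebra A] (α : A →⋆ₐ[ℂ] A) (L : A → A) :
    Prop where
  map_add : ∀ x y, L (x + y) = L x + L y
  map_smul : ∀ (r : ℂ) (x), L (r • x) = r • L x
  map_mul_mul : ∀ x a y, L (α x * a * α y) = x * L a * y
  map_one : L 1 = 1
  positive : ∀ x, ∃ y, L (star x * x) = star y * y

variable {A : Type u} [CStarAlgebra A] {α : A →⋆ₐ[ℂ] A}

/-- An injective ⋆-homomorphism of C⋆-algebras reflects positivity. -/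
theorem exists_eq_star_mul_self_of_map {B : Type v} [CStarAlgebra B] {g : A →⋆ₐ[ℂ] B}
    (hg : Function.Injective g) {d : A} {b : B} (h : g d = star b * b) :
    ∃ y, d = star y * y := by
  let _ := CStarAlgebra.spectralOrder A
  let _ := CStarAlgebra.spectralOrderedRing A
  let _ := CStarAlgebra.spectralOrder B
  let _ := CStarAlgebra.spectralOrderedRing B
  rw [← CStarAlgebra.nonneg_iff_eq_star_mul_self]
  have hd : IsSelfAdjoint d := hg (by rw [map_star, h]; simp)
  set p := star b * b
  have hp : 0 ≤ p := star_mul_self_nonneg b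
  have hp1 : p ≤ algebraMap ℝ B ‖p‖ := (IsSelfAdjoint.of_nonneg hp).le_algebraMap_norm_self
  -- For a self-adjoint element this inequality encodes positivity, and it pulls back along g
  -- because injective ⋆-homomorphisms are isometric.
  have h2 : ‖algebraMap ℝ B ‖p‖ - p‖ ≤ ‖p‖ := by
    rw [CStarAlgebra.norm_le_iff_le_algebraMap _ (norm_nonneg p) (sub_nonneg.2 hp1)]
    exact sub_le_self _ hp
  have hmap : g (algebraMap ℝ A ‖p‖) = algebraMap ℝ B ‖p‖ := by
    rw [IsScalarTower.algebraMap_apply ℝ ℂ A, IsScalarTower.algebraMap_apply ℝ ℂ B]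
    exact g.toAlgHom.commutes _
  rw [← hmap, ← h, ← map_sub, NonUnitalStarAlgHom.norm_map g hg] at h2
  have hsa : IsSelfAdjoint (algebraMap ℝ A ‖g d‖ - d) := (IsSelfAdjoint.algebraMap A (.all _)).sub hd
  have h3 : algebraMap ℝ A ‖g d‖ - d ≤ algebraMap ℝ A ‖g d‖ :=
    hsa.le_algebraMap_norm_self.trans (algebraMap_mono A h2)
  simpa using h3

theorem apply_transferOperator {E : A → A} (hE : IsConditionalExpectation α.range E) (a : A) :
    α (transferOperator α E a) = E a :=
  Function.invFun_eq (hE.mem a)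

/-- As α ∘ L = E, each algebraic identity can be checked after applying the injective α, where it is
a property of E; positivity is reflected by α. -/
theorem isTransferOperator_transferOperator (hα : Function.Injective α) {E : A → A}
    (hE : IsConditionalExpectation α.range E) : IsTransferOperator α (transferOperator α E) where
  map_add x y := hα (by simp only [map_add, apply_transferOperator hE, hE.map_add])
  map_smul r x := hα (by simp only [map_smul, apply_transferOperator hE, hE.map_smul])
  map_mul_mul x a y := hα (by
    simp only [map_mul, apply_transferOperator hE]
    rw [hE.map_mul_right _ (α y) ⟨y, rfl⟩, hE.map_mul_left _ (α x) ⟨x, rfl⟩])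
  map_one := hα (by rw [apply_transferOperator hE, map_one, hE.map_of_mem 1 (one_mem _)])
  positive x := by
    obtain ⟨b, hb⟩ := hE.positive x
    exact exists_eq_star_mul_self_of_map hα ((apply_transferOperator hE _).trans hb)

namespace IsTransferOperator

variable {L : A → A}

/-- A transfer operator as a linear map. -/
def toLinearMap (hL : IsTransferOperator α L) : A →ₗ[ℂ] A where
  toFun := L
  map_add' := hL.map_add
  map_smul' := hL.map_smul

/-- The state `φ ∘ Lⁿ`. -/
def iterState (hL : IsTransferOperator α L) (φ : A →ₗ[ℂ] ℂ) (n : ℕ) : A →ₗ[ℂ] ℂ :=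
  φ ∘ₗ hL.toLinearMap ^ n

theorem iterState_zero (hL : IsTransferOperator α L) (φ : A →ₗ[ℂ] ℂ) : hL.iterState φ 0 = φ := rfl

theorem iterState_succ (hL : IsTransferOperator α L) (φ : A →ₗ[ℂ] ℂ) (n : ℕ) (a : A) :
    hL.iterState φ (n + 1) a = hL.iterState φ n (L a) := by
  rw [iterState, pow_succ]; rfl

theorem isState_iterState (hL : IsTransferOperator α L) {φ : A →ₗ[ℂ] ℂ} (hφ : IsState φ) (n : ℕ) :
    IsState (hL.iterState φ n) := by
  induction n with
  | zero => exact hφ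
  | succ n ih =>
    refine ⟨fun x => ?_, ?_⟩
    · obtain ⟨y, hy⟩ := hL.positive x
      rw [iterState_succ, hy]
      exact ih.nonneg y
    · rw [iterState_succ, hL.map_one, ih.map_one]

end IsTransferOperator

end TransferOperator

/-! ### The Fock representation attached to a state of A -/

noncomputable section Fock

open scoped ComplexOrder InnerProductSpace BoundedContinuousFunction

namespace Fock

variable (A : Type u) [CStarAlgebra A]

instance : CStarAlgebra (ℕ →ᵇ A) where

/-- The spectral order on the C⋆-algebra of bounded sequences. -/
abbrev seqPartialOrder : PartialOrder (ℕ →ᵇ A) := CStarAlgebra.spectralOrder _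

attribute [local instance] seqPartialOrder

theorem seqStarOrderedRing : StarOrderedRing (ℕ →ᵇ A) := CStarAlgebra.spectralOrderedRing _

attribute [local instance] seqStarOrderedRing

/-- Constant sequences. -/
def const : A →⋆ₐ[ℂ] (ℕ →ᵇ A) where
  toFun a := .const ℕ a
  map_one' := rfl
  map_mul' _ _ := rfl
  map_zero' := rfl
  map_add' _ _ := rfl
  commutes' _ := rfl
  map_star' _ := rfl

variable {A}

/-- The sequence `(c, 0, 0, …)`. -/
def vac (c : A) : ℕ →ᵇ A :=
  .ofNormedAddCommGroupDiscrete (fun n => if n = 0 then c else 0) ‖c‖ fun n => by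
    split_ifs <;> simp

/-- The shift `f ↦ (0, √2 α(f₀), √2 α(f₁), …)`. -/
def shift (α : A →⋆ₐ[ℂ] A) : (ℕ →ᵇ A) →ₗ[ℂ] (ℕ →ᵇ A) where
  toFun f := .ofNormedAddCommGroupDiscrete
    (fun n => n.casesOn 0 fun m => (√2 : ℂ) • α (f m)) (√2 * ‖f‖) fun n => by
      cases n with
      | zero => simp
      | succ m =>
        refine (norm_smul_le _ _).trans ?_
        have := (NonUnitalStarAlgHom.norm_apply_le α (f m)).trans (f.norm_coe_le_norm m)
        rw [Complex.norm_real, Real.norm_of_nonneg (Real.sqrt_nonneg _)]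
        gcongr
  map_add' f g := by ext n; cases n <;> simp
  map_smul' r f := by
    ext n
    cases n with
    | zero => exact (smul_zero r).symm
    | succ n =>
      change (√2 : ℂ) • α (r • f n) = r • ((√2 : ℂ) • α (f n))
      rw [map_smul, smul_comm]

theorem shift_zero (α : A →⋆ₐ[ℂ] A) (f : ℕ →ᵇ A) : shift α f 0 = 0 := rfl

theorem shift_succ (α : A →⋆ₐ[ℂ] A) (f : ℕ →ᵇ A) (n : ℕ) :
    shift α f (n + 1) = (√2 : ℂ) • α (f n) := rfl

variable {α : A →⋆ₐ[ℂ] A} {L : A → A} (hL : IsTransferOperator α L)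
  {φ : A →ₗ[ℂ] ℂ} (hφ : IsState φ)

include hφ in
theorem summable_functional (f : ℕ →ᵇ A) :
    Summable fun n : ℕ => (1 / 2 : ℂ) ^ n * hL.iterState φ n (f n) := by
  refine Summable.of_norm_bounded (g := fun n : ℕ => (1 / 2 : ℝ) ^ n * ‖f‖)
    (summable_geometric_two.mul_right _) fun n => ?_
  rw [norm_mul, norm_pow]
  have := ((hL.isState_iterState hφ n).norm_apply_le (f n)).trans (f.norm_coe_le_norm n)
  rw [norm_div, norm_one, Complex.norm_ofNat]
  gcongr

/-- The positive functional `f ↦ ∑ 2⁻ⁿ φ(Lⁿ(fₙ))` on bounded sequences. -/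
def functional : (ℕ →ᵇ A) →ₚ[ℂ] ℂ :=
  .mk₀
    -- The weights 2⁻ⁿ make the sum converge for all bounded sequences, so that the GNS construction
    -- applies to a unital C⋆-algebra; the factor √2 in the shift compensates for them.
    { toFun := fun f => ∑' n : ℕ, (1 / 2 : ℂ) ^ n * hL.iterState φ n (f n)
      map_add' := fun f g => by
        rw [← (summable_functional hL hφ f).tsum_add (summable_functional hL hφ g)]
        simp [mul_add]
      map_smul' := fun r f => by
        rw [RingHom.id_apply, smul_eq_mul, ← tsum_mul_left]
        simp [mul_left_comm] }
    fun f hf => by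
      obtain ⟨g, rfl⟩ := CStarAlgebra.nonneg_iff_eq_star_mul_self.1 hf
      refine tsum_nonneg fun n => ?_
      obtain ⟨r, hr, h⟩ := (hL.isState_iterState hφ n).nonneg (g n)
      have : hL.iterState φ n ((star g * g) n) = r := h
      rw [this]
      positivity

theorem functional_apply (f : ℕ →ᵇ A) :
    functional hL hφ f = ∑' n : ℕ, (1 / 2 : ℂ) ^ n * hL.iterState φ n (f n) := rfl

theorem functional_vac (c : A) : functional hL hφ (vac c) = φ c := by
  rw [functional_apply, tsum_eq_single 0]
  · simp [vac, IsTransferOperator.iterState_zero]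
  · intro n hn
    simp [vac, hn]

/-- Shifting moves level n to level n + 1: the two factors √2 cancel the extra weight 1/2, and
L(α(x) a α(y)) = x L(a) y removes one iterate of L. This is the relation Ŝ* a Ŝ = L(a) in weak form.
-/
theorem functional_shift (a : A) (f g : ℕ →ᵇ A) :
    functional hL hφ (star (shift α f) * (const A a * shift α g)) =
      functional hL hφ (star f * (const A (L a) * g)) := by
  rw [functional_apply, functional_apply, (summable_functional hL hφ _).tsum_eq_zero_add]
  have h0 : (star (shift α f) * (const A a * shift α g)) 0 = 0 := by
    change star (shift α f 0) * (a * shift α g 0) = 0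
    simp [shift_zero]
  rw [h0, map_zero, mul_zero, zero_add]
  congr 1; ext n
  have h1 : (star (shift α f) * (const A a * shift α g)) (n + 1) =
      (2 : ℂ) • (α (star (f n)) * a * α (g n)) := by
    change star (shift α f (n + 1)) * (a * shift α g (n + 1)) = _
    rw [shift_succ, shift_succ, star_smul, mul_smul_comm, smul_mul_smul_comm, map_star, mul_assoc]
    congr 1
    rw [Complex.star_def, Complex.conj_ofReal, ← Complex.ofReal_mul]
    simp
  rw [h1, map_smul, IsTransferOperator.iterState_succ, hL.map_mul_mul, pow_succ, smul_eq_mul,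
    mul_assoc]
  change _ = (1 / 2 : ℂ) ^ n * hL.iterState φ n (star (f n) * (L a * g n))
  rw [mul_assoc (star (f n))]
  ring

/-- Shifted sequences vanish at 0 and vacuum sequences vanish elsewhere. This orthogonality is why
Ŝ* kills the vacuum vectors. -/
theorem functional_star_shift_mul_vac (f : ℕ →ᵇ A) (c : A) :
    functional hL hφ (star (shift α f) * vac c) = 0 := by
  have : star (shift α f) * vac c = 0 := by
    ext n
    change star (shift α f n) * vac c n = 0
    cases n with
    | zero => simp [shift_zero]
    | succ n => simp [vac]
  rw [this, map_zero]

/-- The Fock space of a state. -/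
abbrev Space : Type u := (functional hL hφ).GNS

/-- The inclusion of bounded sequences in the Fock space. -/
def toSpace (f : ℕ →ᵇ A) : Space hL hφ := ((functional hL hφ).toPreGNS f : (functional hL hφ).GNS)

theorem inner_toSpace (f g : ℕ →ᵇ A) :
    ⟪toSpace hL hφ f, toSpace hL hφ g⟫_ℂ = functional hL hφ (star f * g) := by
  rw [toSpace, toSpace, UniformSpace.Completion.inner_coe, PositiveLinearMap.preGNS_inner_def]
  rfl

theorem ext_inner_toSpace {ξ η : Space hL hφ}
    (h : ∀ f, ⟪toSpace hL hφ f, ξ⟫_ℂ = ⟪toSpace hL hφ f, η⟫_ℂ) : ξ = η := by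
  refine ext_inner_left ℂ fun v => ?_
  induction v using UniformSpace.Completion.induction_on with
  | hp => apply isClosed_eq <;> fun_prop
  | ih f => exact h f

theorem clm_ext {T U : Space hL hφ →L[ℂ] Space hL hφ}
    (h : ∀ f, T (toSpace hL hφ f) = U (toSpace hL hφ f)) : T = U := by
  ext v
  induction v using UniformSpace.Completion.induction_on with
  | hp => apply isClosed_eq <;> fun_prop
  | ih f => exact h f

/-- The diagonal action of `A` on the Fock space. -/
def diag : A →⋆ₐ[ℂ] (Space hL hφ →L[ℂ] Space hL hφ) :=
  (functional hL hφ).gnsStarAlgHom.comp (const A)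

theorem diag_toSpace (a : A) (f : ℕ →ᵇ A) :
    diag hL hφ a (toSpace hL hφ f) = toSpace hL hφ (const A a * f) :=
  PositiveLinearMap.gnsNonUnitalStarAlgHom_apply_coe ..

/-- The creation operator on the dense subspace of the Fock space. -/
def preShift : (functional hL hφ).PreGNS →L[ℂ] (functional hL hφ).PreGNS :=
  ((functional hL hφ).toPreGNS.toLinearMap ∘ₗ shift α ∘ₗ
    (functional hL hφ).ofPreGNS.toLinearMap).mkContinuous 1 fun f => by
      -- With a = 1 and L(1) = 1 the shift identity says that the shift preserves the GNS seminorm.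
      have h := functional_shift hL hφ 1 ((functional hL hφ).ofPreGNS f)
        ((functional hL hφ).ofPreGNS f)
      rw [hL.map_one, map_one, one_mul, one_mul] at h
      rw [one_mul, PositiveLinearMap.preGNS_norm_def, PositiveLinearMap.preGNS_norm_def]
      exact (congrArg (fun z : ℂ => √z.re) h).le

/-- The creation operator on the Fock space. -/
def creation : Space hL hφ →L[ℂ] Space hL hφ := (preShift hL hφ).completion

theorem creation_toSpace (f : ℕ →ᵇ A) :
    creation hL hφ (toSpace hL hφ f) = toSpace hL hφ (shift α f) := by
  rw [creation, toSpace, ContinuousLinearMap.completion_apply_coe]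
  rfl

theorem const_mul_vac (a c : A) : const A a * vac c = vac (a * c) := by
  ext n
  change a * vac c n = vac (a * c) n
  by_cases hn : n = 0 <;> simp [vac, hn]

theorem star_vac_mul_vac (b c : A) : star (vac b) * vac c = vac (star b * c) := by
  ext n
  change star (vac b n) * vac c n = vac (star b * c) n
  by_cases hn : n = 0 <;> simp [vac, hn]

/-- The Fock representation of the Toeplitz relations. -/
def pair : ToeplitzPair α L (Space hL hφ →L[ℂ] Space hL hφ) where
  hom := diag hL hφ
  S := creation hL hφ
  S_mul a := clm_ext hL hφ fun f => by
    rw [mul_apply_eq_comp, mul_apply_eq_comp, diag_toSpace,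
      creation_toSpace, creation_toSpace, diag_toSpace]
    congr 1
    ext n
    cases n with
    | zero =>
      change 0 = α a * shift α f 0
      rw [shift_zero, mul_zero]
    | succ n =>
      change (√2 : ℂ) • α (a * f n) = α a * shift α f (n + 1)
      rw [shift_succ, map_mul, mul_smul_comm]
  star_S_mul_S a := clm_ext hL hφ fun g => ext_inner_toSpace hL hφ fun f => by
    rw [mul_apply_eq_comp, mul_apply_eq_comp,
      ContinuousLinearMap.star_eq_adjoint, ContinuousLinearMap.adjoint_inner_right,
      creation_toSpace, creation_toSpace, diag_toSpace, diag_toSpace, inner_toSpace, inner_toSpace,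
      functional_shift]

/-- The vacuum vectors of the Fock space. -/
def vacuum (c : A) : Space hL hφ := toSpace hL hφ (vac c)

theorem diag_vacuum (a c : A) : diag hL hφ a (vacuum hL hφ c) = vacuum hL hφ (a * c) := by
  rw [vacuum, diag_toSpace, const_mul_vac, vacuum]

theorem star_creation_vacuum (c : A) : star (creation hL hφ) (vacuum hL hφ c) = 0 :=
  ext_inner_toSpace hL hφ fun f => by
    rw [ContinuousLinearMap.star_eq_adjoint, ContinuousLinearMap.adjoint_inner_right,
      creation_toSpace, vacuum, inner_toSpace, functional_star_shift_mul_vac, inner_zero_right]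

theorem norm_sq_vacuum (c : A) : (‖vacuum hL hφ c‖ ^ 2 : ℂ) = φ (star c * c) := by
  rw [← functional_vac hL hφ, ← star_vac_mul_vac, ← inner_toSpace, inner_self_eq_norm_sq_to_K]
  rfl

end Fock

end Fock

/-! ### Averages and square roots of positive elements -/

section Generalities

variable {B : Type u} [CStarAlgebra B]

theorem exists_starSubalgebra_eq_closure (M : StarSubalgebra ℂ B) :
    ∃ P : StarSubalgebra ℂ B, (P : Set B) = closure M :=
  ⟨M.topologicalClosure, rfl⟩

/-- Averages of positive elements are positive. -/
theorem exists_smul_integral_star_mul_self_eq {F : ℝ → B} {r a b : ℝ} (hr : 0 ≤ r) (hab : a ≤ b) :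
    ∃ c, r • ∫ t in a..b, star (F t) * F t = star c * c := by
  let _ := CStarAlgebra.spectralOrder B
  let _ := CStarAlgebra.spectralOrderedRing B
  rw [← CStarAlgebra.nonneg_iff_eq_star_mul_self, intervalIntegral.integral_of_le hab]
  exact smul_nonneg hr (MeasureTheory.integral_nonneg fun t => star_mul_self_nonneg _)

/-- The positive square root of `x* x` is fixed by all endomorphisms which fix `x* x`. -/
theorem exists_star_mul_self_eq_fixed (x : B) :
    ∃ q, star x * x = star q * q ∧
      ∀ g : B →⋆ₐ[ℂ] B, g (star x * x) = star x * x → g q = q := by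
  let _ := CStarAlgebra.spectralOrder B
  let _ := CStarAlgebra.spectralOrderedRing B
  have hp : 0 ≤ star x * x := star_mul_self_nonneg x
  have hq : IsSelfAdjoint (CFC.sqrt (star x * x)) := .of_nonneg (CFC.sqrt_nonneg _)
  refine ⟨CFC.sqrt (star x * x), ?_, fun g hg => ?_⟩
  · rw [hq.star_eq, CFC.sqrt_mul_sqrt_self _ hp]
  · symm
    -- Uniqueness of the positive square root: g(q) squares to g(x* x) = x* x, and it is positive
    -- since q is itself a square r* r.
    refine CFC.sqrt_unique ?_ ?_
    · rw [← map_mul, CFC.sqrt_mul_sqrt_self _ hp, hg]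
    · rw [← CFC.sqrt_mul_sqrt_self (CFC.sqrt (star x * x)) (CFC.sqrt_nonneg _), map_mul]
      have : IsSelfAdjoint (CFC.sqrt (CFC.sqrt (star x * x))) := .of_nonneg (CFC.sqrt_nonneg _)
      nth_rw 1 [← this.star_eq]
      rw [map_star]
      exact star_mul_self_nonneg _

end Generalities

/-! ### Monomials in the Toeplitz algebra, and the mean P̂ -/

noncomputable section ToeplitzStructure

namespace Toeplitz

variable {A : Type u} [CStarAlgebra A] (α : A →⋆ₐ[ℂ] A) (L : A → A)

theorem S_pow_mul (n : ℕ) (a : A) : S α L ^ n * ι α L a = ι α L (α^[n] a) * S α L ^ n := by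
  induction n generalizing a with
  | zero => simp
  | succ n ih =>
    rw [pow_succ, mul_assoc, S_mul, ← mul_assoc, ih, mul_assoc, Function.iterate_succ_apply]

theorem mul_star_S_pow (n : ℕ) (a : A) :
    ι α L a * star (S α L) ^ n = star (S α L) ^ n * ι α L (α^[n] a) := by
  have h := congrArg star (S_pow_mul α L n (star a))
  have h' : α^[n] (star a) = star (α^[n] a) :=
    (Function.Semiconj.iterate_right (f := star) (fun a => (map_star α a).symm) n a).symm
  rw [h'] at h
  simpa only [star_mul, star_pow, ← map_star, star_star] using h

theorem star_S_pow_mul_S_pow (n : ℕ) (a : A) :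
    star (S α L) ^ n * ι α L a * S α L ^ n = ι α L (L^[n] a) := by
  induction n generalizing a with
  | zero => simp
  | succ n ih =>
    rw [Function.iterate_succ_apply, ← ih, ← star_S_mul_S, pow_succ, pow_succ']
    simp only [mul_assoc]

/-- The elements `a Sⁿ S*ᵐ b` of the Toeplitz algebra. -/
def monomial (a : A) (n m : ℕ) (b : A) : Toeplitz α L :=
  ι α L a * S α L ^ n * star (S α L) ^ m * ι α L b

theorem star_monomial (a : A) (n m : ℕ) (b : A) :
    star (monomial α L a n m b) = monomial α L (star b) m n (star a) := by
  simp only [monomial, star_mul, star_pow, star_star, map_star, mul_assoc]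

/-- The middle part Ŝ*ᵐ bc Ŝᵏ reduces to an iterate of L at bc with a leftover power of Ŝ or of Ŝ*.
The coefficient is then pushed outwards through Ŝⁿ or Ŝ*ˡ by the covariance relation. -/
theorem exists_monomial_mul (a b c d : A) (n m k l : ℕ) :
    ∃ e p q g, monomial α L a n m b * monomial α L c k l d = monomial α L e p q g := by
  have h0 : monomial α L a n m b * monomial α L c k l d =
      ι α L a * S α L ^ n * (star (S α L) ^ m * ι α L (b * c) * S α L ^ k) *
        star (S α L) ^ l * ι α L d := by
    simp only [monomial, map_mul, mul_assoc]
  rcases le_total m k with h | h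
  · obtain ⟨j, rfl⟩ := Nat.exists_eq_add_of_le h
    refine ⟨a * α^[n] (L^[m] (b * c)), n + j, l, d, ?_⟩
    rw [h0, pow_add, ← mul_assoc (star (S α L) ^ m * ι α L (b * c)), star_S_pow_mul_S_pow,
      monomial, map_mul, pow_add]
    have := S_pow_mul α L n (L^[m] (b * c))
    calc _ = ι α L a * (S α L ^ n * ι α L (L^[m] (b * c))) * S α L ^ j *
          star (S α L) ^ l * ι α L d := by simp only [mul_assoc]
      _ = _ := by rw [this]; simp only [mul_assoc]
  · obtain ⟨j, rfl⟩ := Nat.exists_eq_add_of_le h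
    refine ⟨a, n, j + l, α^[l] (L^[k] (b * c)) * d, ?_⟩
    have h1 : star (S α L) ^ (k + j) * ι α L (b * c) * S α L ^ k =
        star (S α L) ^ j * ι α L (L^[k] (b * c)) := by
      rw [add_comm, pow_add, ← star_S_pow_mul_S_pow]; simp only [mul_assoc]
    have := mul_star_S_pow α L l (L^[k] (b * c))
    rw [h0, h1, monomial, map_mul, pow_add]
    calc _ = ι α L a * S α L ^ n * star (S α L) ^ j * (ι α L (L^[k] (b * c)) * star (S α L) ^ l) *
          ι α L d := by simp only [mul_assoc]
      _ = _ := by rw [this]; simp only [mul_assoc]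

/-- The linear span of the elements `a Sⁿ S*ᵐ b`. -/
def monomialSpan : Submodule ℂ (Toeplitz α L) :=
  Submodule.span ℂ {x | ∃ a n m b, x = monomial α L a n m b}

theorem monomial_mem_span (a : A) (n m : ℕ) (b : A) : monomial α L a n m b ∈ monomialSpan α L :=
  Submodule.subset_span ⟨a, n, m, b, rfl⟩

theorem ι_eq_monomial (a : A) : ι α L a = monomial α L a 0 0 1 := by simp [monomial]

theorem S_eq_monomial : S α L = monomial α L 1 1 0 1 := by simp [monomial]

/-- The elements `a Sⁿ S*ᵐ b` span a ⋆-subalgebra. -/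
def monomialSubalgebra : StarSubalgebra ℂ (Toeplitz α L) where
  carrier := monomialSpan α L
  add_mem' := (monomialSpan α L).add_mem
  mul_mem' {x y} hx hy := by
    refine Submodule.span_induction₂ (p := fun x y _ _ => x * y ∈ monomialSpan α L) ?_
      ?_ ?_ ?_ ?_ ?_ ?_ hx hy
    · rintro _ _ ⟨a, n, m, b, rfl⟩ ⟨c, k, l, d, rfl⟩
      obtain ⟨e, p, q, g, h⟩ := exists_monomial_mul α L a b c d n m k l
      rw [h]
      exact monomial_mem_span α L e p q g
    · intro y _; rw [zero_mul]; exact zero_mem _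
    · intro y _; rw [mul_zero]; exact zero_mem _
    · intro x y z _ _ _ hx hy; rw [add_mul]; exact add_mem hx hy
    · intro x y z _ _ _ hx hy; rw [mul_add]; exact add_mem hx hy
    · intro r x y _ _ h; rw [smul_mul_assoc]; exact Submodule.smul_mem _ _ h
    · intro r x y _ _ h; rw [mul_smul_comm]; exact Submodule.smul_mem _ _ h
  algebraMap_mem' r := by
    have : algebraMap ℂ (Toeplitz α L) r = ι α L (algebraMap ℂ A r) :=
      ((ι α L).toAlgHom.commutes r).symm
    rw [this, ι_eq_monomial]
    exact monomial_mem_span α L _ 0 0 1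
  star_mem' {x} hx := by
    refine Submodule.span_induction (p := fun x _ => star x ∈ monomialSpan α L) ?_ ?_ ?_ ?_ hx
    · rintro _ ⟨a, n, m, b, rfl⟩
      rw [star_monomial]
      exact monomial_mem_span α L _ _ _ _
    · rw [star_zero]; exact zero_mem _
    · intro x y _ _ hx hy; rw [star_add]; exact add_mem hx hy
    · intro r x _ h; rw [star_smul]; exact Submodule.smul_mem _ _ h

theorem mem_closure_monomialSpan (x : Toeplitz α L) :
    x ∈ closure (monomialSpan α L : Set (Toeplitz α L)) := by
  obtain ⟨P, hP⟩ := exists_starSubalgebra_eq_closure (monomialSubalgebra α L)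
  have hle : ∀ y ∈ monomialSpan α L, y ∈ P := fun y hy => by
    rw [← SetLike.mem_coe, hP]
    exact subset_closure hy
  have hx := closed_induction α L P (hP ▸ isClosed_closure)
    (fun a => hle _ (ι_eq_monomial α L a ▸ monomial_mem_span α L _ _ _ _))
    (hle _ (S_eq_monomial α L ▸ monomial_mem_span α L _ _ _ _)) x
  rwa [← SetLike.mem_coe, hP] at hx

/-- A closed subspace which contains all `a Sⁿ S*ᵐ b` is everything. -/
theorem monomial_induction (P : Submodule ℂ (Toeplitz α L))
    (hP : IsClosed (P : Set (Toeplitz α L))) (h : ∀ a n m b, monomial α L a n m b ∈ P)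
    (x : Toeplitz α L) : x ∈ P := by
  have hle : monomialSpan α L ≤ P := Submodule.span_le.2 (by
    rintro _ ⟨a, n, m, b, rfl⟩
    exact h a n m b)
  exact closure_minimal hle hP (mem_closure_monomialSpan α L x)

/-! ### The mean over the circle -/

theorem continuous_gaugeOrbit (x : Toeplitz α L) :
    Continuous fun t : ℝ => circleGauge α L (Circle.exp t) x :=
  (continuous_circleGauge α L x).comp Circle.exp.continuous

theorem circleMean_add (x y : Toeplitz α L) :
    circleMean α L (x + y) = circleMean α L x + circleMean α L y := by
  simp only [circleMean, map_add]
  rw [intervalIntegral.integral_add ((continuous_gaugeOrbit α L x).intervalIntegrable _ _)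
    ((continuous_gaugeOrbit α L y).intervalIntegrable _ _), smul_add]

theorem circleMean_smul (r : ℂ) (x : Toeplitz α L) :
    circleMean α L (r • x) = r • circleMean α L x := by
  simp only [circleMean, map_smul]
  rw [intervalIntegral.integral_smul, smul_comm]

theorem norm_circleMean_le (x : Toeplitz α L) : ‖circleMean α L x‖ ≤ ‖x‖ := by
  have h := intervalIntegral.norm_integral_le_of_norm_le_const (a := 0) (b := 2 * Real.pi)
    (f := fun t : ℝ => circleGauge α L (Circle.exp t) x) (C := ‖x‖)
    fun t _ => NonUnitalStarAlgHom.norm_apply_le _ x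
  rw [sub_zero, abs_of_pos Real.two_pi_pos] at h
  rw [circleMean, norm_smul, Real.norm_of_nonneg (by positivity), inv_mul_le_iff₀ (by positivity),
    mul_comm _ ‖x‖]
  exact h

/-- `P̂` as a continuous linear map. -/
def circleMeanCLM : Toeplitz α L →L[ℂ] Toeplitz α L :=
  LinearMap.mkContinuous
    { toFun := circleMean α L
      map_add' := circleMean_add α L
      map_smul' := circleMean_smul α L } 1 fun x =>
      (norm_circleMean_le α L x).trans_eq (one_mul _).symm

theorem circleMeanCLM_apply (x : Toeplitz α L) : circleMeanCLM α L x = circleMean α L x := rfl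

theorem circleMean_of_mem {x : Toeplitz α L} (hx : x ∈ fixed α L) : circleMean α L x = x := by
  have h : ∀ z, circleGauge α L z x = x := hx
  simp only [circleMean, h]
  rw [intervalIntegral.integral_const, smul_smul, sub_zero,
    inv_mul_cancel₀ Real.two_pi_pos.ne', one_smul]

theorem circleMean_mul_left {y : Toeplitz α L} (hy : y ∈ fixed α L) (x : Toeplitz α L) :
    circleMean α L (y * x) = y * circleMean α L x := by
  have h : ∀ z, circleGauge α L z y = y := hy
  simp only [circleMean, map_mul, h]
  rw [mul_smul_comm]
  congr 1
  exact (ContinuousLinearMap.mul ℂ (Toeplitz α L) y).intervalIntegral_comp_comm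
    ((continuous_gaugeOrbit α L x).intervalIntegrable _ _)

theorem circleMean_mul_right {y : Toeplitz α L} (hy : y ∈ fixed α L) (x : Toeplitz α L) :
    circleMean α L (x * y) = circleMean α L x * y := by
  have h : ∀ z, circleGauge α L z y = y := hy
  simp only [circleMean, map_mul, h]
  rw [smul_mul_assoc]
  congr 1
  exact ((ContinuousLinearMap.mul ℂ (Toeplitz α L)).flip y).intervalIntegral_comp_comm
    ((continuous_gaugeOrbit α L x).intervalIntegrable _ _)

theorem circleMean_positive (x : Toeplitz α L) :
    ∃ b, circleMean α L (star x * x) = star b * b := by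
  simp only [circleMean, map_mul, map_star]
  exact exists_smul_integral_star_mul_self_eq (by positivity) Real.two_pi_pos.le

theorem isConditionalExpectation_circleMean :
    IsConditionalExpectation (fixed α L) (circleMean α L) where
  map_add := circleMean_add α L
  map_smul := circleMean_smul α L
  mem := circleMean_mem_fixed α L
  map_of_mem _ hx := circleMean_of_mem α L hx
  map_mul_left x _ hy := circleMean_mul_left α L hy x
  map_mul_right x _ hy := circleMean_mul_right α L hy x
  positive := circleMean_positive α L

theorem circleGauge_monomial (z : Circle) (a : A) (n m : ℕ) (b : A) :
    circleGauge α L z (monomial α L a n m b) =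
      ((z : ℂ) ^ n * star (z : ℂ) ^ m) • monomial α L a n m b := by
  simp only [monomial, map_mul, map_pow, map_star, circleGauge_ι, circleGauge_S, star_smul,
    smul_pow, mul_smul_comm, smul_mul_assoc, smul_smul, mul_comm]

theorem monomial_mem_fixed (a : A) (n : ℕ) (b : A) : monomial α L a n n b ∈ fixed α L := by
  have := mul_mem (mul_mem (ι_mem_fixed α L a) (S_pow_mem_fixed α L n)) (ι_mem_fixed α L b)
  simpa only [monomial, mul_assoc] using this

/-- The gauge action multiplies the monomial by the character e^{i(n-m)t}, which has mean zero over
a period. -/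
theorem circleMean_monomial_of_ne (a : A) {n m : ℕ} (hnm : n ≠ m) (b : A) :
    circleMean α L (monomial α L a n m b) = 0 := by
  have h : ∀ t : ℝ, circleGauge α L (Circle.exp t) (monomial α L a n m b) =
      Complex.exp ((Complex.I * ((n : ℂ) - m)) * t) • monomial α L a n m b := fun t => by
    rw [circleGauge_monomial]
    congr 1
    rw [Circle.coe_exp, Complex.star_def, ← Complex.exp_conj, ← Complex.exp_nat_mul,
      ← Complex.exp_nat_mul, ← Complex.exp_add]
    congr 1
    simp
    ring
  have hne : Complex.I * ((n : ℂ) - m) ≠ 0 :=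
    mul_ne_zero Complex.I_ne_zero (sub_ne_zero.2 (by exact_mod_cast hnm))
  simp only [circleMean, h]
  rw [intervalIntegral.integral_smul_const, integral_exp_mul_complex hne]
  have hper : Complex.exp (Complex.I * ((n : ℂ) - m) * ((2 * Real.pi : ℝ) : ℂ)) = 1 := by
    rw [Complex.exp_eq_one_iff]
    exact ⟨(n : ℤ) - m, by push_cast; ring⟩
  rw [hper]
  simp

/-- A positive element of `Û` is of the form `q* q` with `q ∈ Û`. -/
theorem exists_mem_fixed_eq_star_mul_self {x : Toeplitz α L} (hx : star x * x ∈ fixed α L) :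
    ∃ q ∈ fixed α L, star x * x = star q * q := by
  obtain ⟨q, hq, h⟩ := exists_star_mul_self_eq_fixed x
  exact ⟨q, fun z => h _ (hx z), hq⟩

/-- `P̂` as a linear map onto `Û`. -/
def expectationLinear : Toeplitz α L →ₗ[ℂ] fixed α L where
  toFun := expectation α L
  map_add' x y := Subtype.ext (circleMean_add α L x y)
  map_smul' r x := Subtype.ext (circleMean_smul α L r x)

theorem expectation_of_mem (x : fixed α L) : expectation α L x = x :=
  Subtype.ext (circleMean_of_mem α L x.2)

/-- Since π is defined on Û only, positivity needs P̂(x* x) in the form q* q with q in Û; the square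
root of a gauge-invariant element provides it. -/
theorem isState_comp_expectation {φ : A →ₗ[ℂ] ℂ} (hφ : IsState φ) (π : fixed α L →⋆ₐ[ℂ] A) :
    IsState (φ ∘ₗ π.toAlgHom.toLinearMap ∘ₗ expectationLinear α L) where
  nonneg x := by
    obtain ⟨b, hb⟩ := circleMean_positive α L x
    obtain ⟨q, hq, hbq⟩ := exists_mem_fixed_eq_star_mul_self α L
      (hb ▸ circleMean_mem_fixed α L (star x * x))
    have h : expectation α L (star x * x) = star (⟨q, hq⟩ : fixed α L) * ⟨q, hq⟩ :=
      Subtype.ext (hb.trans hbq)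
    obtain ⟨r, hr, h'⟩ := hφ.nonneg (π ⟨q, hq⟩)
    refine ⟨r, hr, ?_⟩
    change φ (π (expectation α L (star x * x))) = r
    rw [h, map_mul, map_star, h']
  map_one := by
    change φ (π (expectation α L 1)) = 1
    rw [show expectation α L 1 = 1 from expectation_of_mem α L 1, map_one, hφ.map_one]

end Toeplitz

end ToeplitzStructure

/-! ### Vacuum states and the homomorphism π -/

noncomputable section VacuumStates

namespace Toeplitz

variable {A : Type u} [CStarAlgebra A] (α : A →⋆ₐ[ℂ] A) (L : A → A)

/-- A state of the Toeplitz algebra in whose GNS representation `S*` annihilates the images of the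
cyclic vector under `A`. -/
structure IsVacuumState (ψ : Toeplitz α L →ₗ[ℂ] ℂ) : Prop where
  isState : IsState ψ
  apply_eq_zero : ∀ b, ψ (star (star (S α L) * ι α L b) * (star (S α L) * ι α L b)) = 0

variable {α L}

namespace IsVacuumState

variable {ψ : Toeplitz α L →ₗ[ℂ] ℂ}

/-- By Cauchy–Schwarz, a null vector of ψ is orthogonal to everything. -/
theorem apply_mul_star_S_mul (hψ : IsVacuumState α L ψ) (x : Toeplitz α L) (b : A) :
    ψ (x * (star (S α L) * ι α L b)) = 0 := by
  have h := hψ.isState.norm_apply_star_mul_le (star x) (star (S α L) * ι α L b)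
  rw [hψ.apply_eq_zero, star_star, Complex.zero_re, Real.sqrt_zero, mul_zero] at h
  exact norm_le_zero_iff.1 h

theorem apply_mul_S_mul (hψ : IsVacuumState α L ψ) (a : A) (x : Toeplitz α L) :
    ψ (ι α L a * S α L * x) = 0 := by
  have h := congrArg star (hψ.apply_mul_star_S_mul (star x) (star a))
  rw [← hψ.isState.map_star, star_zero] at h
  simpa only [star_mul, star_star, map_star] using h

theorem apply_monomial_of_right_ne (hψ : IsVacuumState α L ψ) (x : Toeplitz α L) {m : ℕ}
    (hm : m ≠ 0) (b : A) : ψ (x * star (S α L) ^ m * ι α L b) = 0 := by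
  obtain ⟨j, rfl⟩ := Nat.exists_eq_succ_of_ne_zero hm
  rw [Nat.succ_eq_add_one, pow_succ, ← mul_assoc, mul_assoc _ (star (S α L))]
  exact hψ.apply_mul_star_S_mul _ b

theorem apply_monomial_of_left_ne (hψ : IsVacuumState α L ψ) (a : A) {n : ℕ} (hn : n ≠ 0)
    (m : ℕ) (b : A) : ψ (monomial α L a n m b) = 0 := by
  obtain ⟨j, rfl⟩ := Nat.exists_eq_succ_of_ne_zero hn
  rw [← hψ.apply_mul_S_mul a (S α L ^ j * star (S α L) ^ m * ι α L b), monomial,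
    Nat.succ_eq_add_one, pow_succ']
  simp only [mul_assoc]

/-- A vacuum state is determined by its restriction to `A`. -/
theorem ext {ψ₁ ψ₂ : Toeplitz α L →ₗ[ℂ] ℂ} (h₁ : IsVacuumState α L ψ₁)
    (h₂ : IsVacuumState α L ψ₂) (h : ∀ a, ψ₁ (ι α L a) = ψ₂ (ι α L a)) : ψ₁ = ψ₂ := by
  refine LinearMap.ext fun x => monomial_induction α L (LinearMap.eqLocus ψ₁ ψ₂)
    (isClosed_eq h₁.isState.continuous h₂.isState.continuous) (fun a n m b => ?_) x
  change ψ₁ _ = ψ₂ _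
  by_cases hn : n = 0
  · by_cases hm : m = 0
    · subst hn hm
      simpa [monomial] using h (a * b)
    · rw [monomial, h₁.apply_monomial_of_right_ne _ hm, h₂.apply_monomial_of_right_ne _ hm]
  · rw [h₁.apply_monomial_of_left_ne _ hn, h₂.apply_monomial_of_left_ne _ hn]

end IsVacuumState

namespace IsVacuumHom

variable {π : fixed α L →⋆ₐ[ℂ] A}

theorem expectation_ι (hπ : IsVacuumHom α L π) (a : A) : π (expectation α L (ι α L a)) = a := by
  rw [show expectation α L (ι α L a) = ⟨ι α L a, ι_mem_fixed α L a⟩ from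
    expectation_of_mem α L ⟨_, ι_mem_fixed α L a⟩, hπ.map_ι]

/-- The states `φ ∘ π ∘ P̂` are vacuum states. -/
theorem isVacuumState (hπ : IsVacuumHom α L π) {φ : A →ₗ[ℂ] ℂ} (hφ : IsState φ) :
    IsVacuumState α L (φ ∘ₗ π.toAlgHom.toLinearMap ∘ₗ expectationLinear α L) where
  isState := isState_comp_expectation α L hφ π
  apply_eq_zero b := by
    let y : fixed α L := ⟨ι α L (star b), ι_mem_fixed α L _⟩ *
      ⟨S α L ^ 1 * star (S α L) ^ 1, S_pow_mem_fixed α L 1⟩ * ⟨ι α L b, ι_mem_fixed α L b⟩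
    have hy : star (star (S α L) * ι α L b) * (star (S α L) * ι α L b) = y := by
      change _ = ι α L (star b) * (S α L ^ 1 * star (S α L) ^ 1) * ι α L b
      simp only [star_mul, star_star, pow_one, map_star, mul_assoc]
    change φ (π (expectation α L _)) = 0
    rw [hy, expectation_of_mem, map_mul π, map_mul π, hπ.map_S 1 one_pos, mul_zero, zero_mul, map_zero]

/-- For every state φ of A the vacuum states φ ∘ πᵢ ∘ P̂ agree on A, hence everywhere. Evaluated at
d* y with d = π₁(y) - π₂(y), this gives φ(d* d) = 0, and states separate points. -/
theorem unique {π₁ π₂ : fixed α L →⋆ₐ[ℂ] A} (h₁ : IsVacuumHom α L π₁)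
    (h₂ : IsVacuumHom α L π₂) : π₁ = π₂ := by
  refine StarAlgHom.ext fun y => sub_eq_zero.1 (eq_zero_of_forall_isState fun φ hφ => ?_)
  set d := π₁ y - π₂ y with hd
  have h := (h₁.isVacuumState hφ).ext (h₂.isVacuumState hφ) fun a => by
    change φ (π₁ (expectation α L _)) = φ (π₂ (expectation α L _))
    rw [h₁.expectation_ι, h₂.expectation_ι]
  have h' := LinearMap.congr_fun h
    ((⟨ι α L (star d), ι_mem_fixed α L _⟩ : fixed α L) * y : fixed α L)
  change φ (π₁ (expectation α L _)) = φ (π₂ (expectation α L _)) at h'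
  rw [expectation_of_mem, map_mul π₁, map_mul π₂, h₁.map_ι, h₂.map_ι] at h'
  rw [hd, mul_sub, map_sub, h', sub_self]

end IsVacuumHom

/-! ### Existence of the vacuum homomorphism -/

section Existence

variable (hL : IsTransferOperator α L)

/-- The Fock representation of the Toeplitz algebra of a state of `A`. -/
abbrev fockRep {φ : A →ₗ[ℂ] ℂ} (hφ : IsState φ) :
    Toeplitz α L →⋆ₐ[ℂ] (Fock.Space hL hφ →L[ℂ] Fock.Space hL hφ) :=
  lift (Fock.pair hL hφ)

theorem fockRep_ι_vacuum {φ : A →ₗ[ℂ] ℂ} (hφ : IsState φ) (a c : A) :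
    fockRep hL hφ (ι α L a) (Fock.vacuum hL hφ c) = Fock.vacuum hL hφ (a * c) := by
  rw [fockRep, lift_ι]
  exact Fock.diag_vacuum ..

theorem fockRep_star_S_vacuum {φ : A →ₗ[ℂ] ℂ} (hφ : IsState φ) (c : A) :
    fockRep hL hφ (star (S α L)) (Fock.vacuum hL hφ c) = 0 := by
  rw [fockRep, map_star, lift_S]
  exact Fock.star_creation_vacuum ..

/-- `x` acts on the vacuum vectors of all Fock representations as left multiplication by `a`. -/
def ActsAs (x : Toeplitz α L) (a : A) : Prop :=
  ∀ (φ : A →ₗ[ℂ] ℂ) (hφ : IsState φ) (c : A),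
    fockRep hL hφ x (Fock.vacuum hL hφ c) = fockRep hL hφ (ι α L a) (Fock.vacuum hL hφ c) ∧
    -- The clause on the adjoint makes the relation stable under the involution, so that the
    -- resulting map preserves adjoints.
    fockRep hL hφ (star x) (Fock.vacuum hL hφ c) =
      fockRep hL hφ (star (ι α L a)) (Fock.vacuum hL hφ c)

namespace ActsAs

variable {hL} {x y : Toeplitz α L} {a b : A}

variable (hL) in
theorem ι (a : A) : ActsAs hL (ι α L a) a := fun _ _ _ => ⟨rfl, rfl⟩

variable (hL) in
theorem zero : ActsAs hL (0 : Toeplitz α L) 0 := by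
  simpa only [map_zero] using ActsAs.ι hL 0

variable (hL) in
theorem one : ActsAs hL (1 : Toeplitz α L) 1 := by
  simpa only [map_one] using ActsAs.ι hL 1

variable (hL) in
theorem of_algebraMap (r : ℂ) :
    ActsAs hL (algebraMap ℂ (Toeplitz α L) r) (algebraMap ℂ A r) := by
  rw [← (Toeplitz.ι α L).toAlgHom.commutes]
  exact ActsAs.ι hL _

theorem add (hx : ActsAs hL x a) (hy : ActsAs hL y b) : ActsAs hL (x + y) (a + b) :=
  fun φ hφ c => by
    simp only [star_add, map_add, add_apply, (hx φ hφ c).1, (hy φ hφ c).1,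
      (hx φ hφ c).2, (hy φ hφ c).2, and_self]

theorem smul (r : ℂ) (hx : ActsAs hL x a) : ActsAs hL (r • x) (r • a) :=
  fun φ hφ c => by
    simp only [star_smul, map_smul, smul_apply, (hx φ hφ c).1, (hx φ hφ c).2, and_self]

theorem mul (hx : ActsAs hL x a) (hy : ActsAs hL y b) : ActsAs hL (x * y) (a * b) :=
  fun φ hφ c => by
    have h1 := (hx φ hφ (b * c)).1
    have h2 := (hy φ hφ (star a * c)).2
    simp only [star_mul, map_mul, mul_apply_eq_comp, (hy φ hφ c).1, (hx φ hφ c).2]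
    simp only [← map_star] at h2 ⊢
    simp only [fockRep_ι_vacuum] at h1 h2 ⊢
    exact ⟨h1, h2⟩

theorem star (hx : ActsAs hL x a) : ActsAs hL (star x) (star a) :=
  fun φ hφ c => by
    have h := hx φ hφ c
    rw [map_star (Toeplitz.ι α L), star_star, star_star]
    exact h.symm

/-- In the Fock space of a state norming a* a, the vacuum vector of 1 is a unit vector and x sends
it to a vector of norm ‖a‖. The estimate gives both the uniqueness of a and the passage to limits.
-/
theorem norm_le (hx : ActsAs hL x a) : ‖a‖ ≤ ‖x‖ := by
  nontriviality A
  obtain ⟨φ, hφ, h⟩ := exists_isState_apply_eq_norm a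
  have h1 : ‖Fock.vacuum hL hφ 1‖ = 1 := by
    have := Fock.norm_sq_vacuum hL hφ 1
    rw [star_one, one_mul, hφ.map_one] at this
    exact (pow_eq_one_iff_of_nonneg (norm_nonneg _) two_ne_zero).1 (by exact_mod_cast this)
  have h2 : ‖Fock.vacuum hL hφ a‖ = ‖a‖ := by
    have := Fock.norm_sq_vacuum hL hφ a
    rw [h, CStarRing.norm_star_mul_self, ← sq] at this
    exact (sq_eq_sq₀ (norm_nonneg _) (norm_nonneg _)).1 (by exact_mod_cast this)
  have h3 := (hx φ hφ 1).1
  rw [fockRep_ι_vacuum, mul_one] at h3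
  rw [← h2, ← h3]
  refine (ContinuousLinearMap.le_opNorm _ _).trans ?_
  rw [h1, mul_one]
  exact NonUnitalStarAlgHom.norm_apply_le _ x

theorem sub (hx : ActsAs hL x a) (hy : ActsAs hL y b) : ActsAs hL (x - y) (a - b) := by
  simpa [sub_eq_add_neg] using hx.add (hy.smul (-1))

theorem unique (hx : ActsAs hL x a) (hy : ActsAs hL x b) : a = b := by
  have h := (hx.sub hy).norm_le
  rw [sub_self, norm_zero] at h
  exact sub_eq_zero.1 (norm_le_zero_iff.1 h)

theorem monomial_zero (a b : A) : ActsAs hL (monomial α L a 0 0 b) (a * b) := by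
  have : monomial α L a 0 0 b = Toeplitz.ι α L (a * b) := by simp [monomial]
  exact this ▸ ActsAs.ι hL _

/-- The rightmost Ŝ* meets a vacuum vector first and kills it; the adjoint is a monomial of the same
shape. -/
theorem monomial_of_ne (a : A) {n : ℕ} (hn : n ≠ 0) (b : A) :
    ActsAs hL (monomial α L a n n b) 0 := by
  have key : ∀ a b (φ : A →ₗ[ℂ] ℂ) (hφ : IsState φ) (c : A),
      fockRep hL hφ (monomial α L a n n b) (Fock.vacuum hL hφ c) = 0 := fun a b φ hφ c => by
    obtain ⟨j, rfl⟩ := Nat.exists_eq_succ_of_ne_zero hn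
    rw [monomial, Nat.succ_eq_add_one, pow_succ (Star.star (S α L)), ← mul_assoc, map_mul, map_mul,
      mul_apply_eq_comp, mul_apply_eq_comp, fockRep_ι_vacuum, fockRep_star_S_vacuum, map_zero]
  intro φ hφ c
  rw [star_monomial, key, key, map_zero, star_zero, map_zero]
  exact ⟨rfl, rfl⟩

end ActsAs

theorem isClosed_actsAs : IsClosed {p : Toeplitz α L × A | ActsAs hL p.1 p.2} := by
  simp only [ActsAs, Set.ofPred_forall, Set.ofPred_and]
  refine isClosed_iInter fun φ => isClosed_iInter fun hφ => isClosed_iInter fun c => ?_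
  have h1 := starAlgHom_continuous (fockRep hL hφ)
  have h2 := starAlgHom_continuous (ι α L)
  exact (isClosed_eq (by fun_prop) (by fun_prop)).inter (isClosed_eq (by fun_prop) (by fun_prop))

/-- The elements whose mean acts on the vacuum vectors as an element of `A`. -/
def meanActs : Submodule ℂ (Toeplitz α L) where
  carrier := {x | ∃ a, ActsAs hL (circleMean α L x) a}
  add_mem' := by
    rintro x y ⟨a, ha⟩ ⟨b, hb⟩
    exact ⟨a + b, circleMean_add α L x y ▸ ha.add hb⟩
  zero_mem' := ⟨0, by
    rw [← circleMeanCLM_apply, map_zero]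
    exact .zero hL⟩
  smul_mem' := by
    rintro r x ⟨a, ha⟩
    exact ⟨r • a, circleMean_smul α L r x ▸ ha.smul r⟩

/-- P̂ is continuous, and by `ActsAs.norm_le` the elements of A belonging to a convergent sequence
of means form a Cauchy sequence; its limit belongs to the limit mean. -/
theorem isClosed_meanActs : IsClosed (meanActs hL : Set (Toeplitz α L)) := by
  refine isClosed_of_closure_subset fun x hx => ?_
  obtain ⟨w, hw, hlim⟩ := mem_closure_iff_seq_limit.1 hx
  choose a ha using hw
  have hlim' := ((circleMeanCLM α L).continuous.tendsto x).comp hlim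
  have hcau : CauchySeq a := by
    refine Metric.cauchySeq_iff'.2 fun ε hε => ?_
    obtain ⟨N, hN⟩ := Metric.cauchySeq_iff'.1 hlim'.cauchySeq ε hε
    refine ⟨N, fun n hn => lt_of_le_of_lt ?_ (hN n hn)⟩
    rw [dist_eq_norm, dist_eq_norm]
    exact ((ha n).sub (ha N)).norm_le
  obtain ⟨l, hl⟩ := cauchySeq_tendsto_of_complete hcau
  exact ⟨l, (isClosed_actsAs hL).mem_of_tendsto (hlim'.prodMk_nhds hl) (.of_forall ha)⟩

/-- Since x = P̂(x), density of the monomials in the whole algebra suffices, and no separate density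
statement in Û is needed. The mean of a monomial acts as ab if n = m = 0 and as 0 otherwise. -/
theorem exists_actsAs {x : Toeplitz α L} (hx : x ∈ fixed α L) : ∃ a, ActsAs hL x a := by
  have h := monomial_induction α L (meanActs hL) (isClosed_meanActs hL) (fun a n m b => ?_) x
  · obtain ⟨a, ha⟩ := h
    exact ⟨a, circleMean_of_mem α L hx ▸ ha⟩
  · by_cases hnm : n = m
    · subst hnm
      change ∃ c, ActsAs hL (circleMean α L _) c
      rw [circleMean_of_mem α L (monomial_mem_fixed α L a n b)]
      by_cases hn : n = 0
      · subst hn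
        exact ⟨a * b, .monomial_zero a b⟩
      · exact ⟨0, .monomial_of_ne a hn b⟩
    · obtain ⟨c, hc⟩ := (meanActs hL).zero_mem
      refine ⟨c, ?_⟩
      rw [circleMean_monomial_of_ne α L a hnm]
      rwa [← circleMeanCLM_apply, map_zero] at hc

/-- The element of `A` as which an element of `Û` acts on the vacuum vectors. -/
def vacuumFun (x : fixed α L) : A := (exists_actsAs hL x.2).choose

theorem actsAs_vacuumFun (x : fixed α L) : ActsAs hL (x : Toeplitz α L) (vacuumFun hL x) :=
  (exists_actsAs hL x.2).choose_spec

theorem vacuumFun_eq {x : fixed α L} {a : A} (h : ActsAs hL (x : Toeplitz α L) a) :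
    vacuumFun hL x = a :=
  (actsAs_vacuumFun hL x).unique h

/-- The ⋆-homomorphism `Û → A` given by the action on the vacuum vectors. -/
def vacuumHom : fixed α L →⋆ₐ[ℂ] A where
  toFun := vacuumFun hL
  map_one' := vacuumFun_eq hL (.one hL)
  map_mul' x y := vacuumFun_eq hL ((actsAs_vacuumFun hL x).mul (actsAs_vacuumFun hL y))
  map_zero' := vacuumFun_eq hL (.zero hL)
  map_add' x y := vacuumFun_eq hL ((actsAs_vacuumFun hL x).add (actsAs_vacuumFun hL y))
  commutes' r := vacuumFun_eq hL (.of_algebraMap hL r)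
  map_star' x := vacuumFun_eq hL (actsAs_vacuumFun hL x).star

theorem isVacuumHom_vacuumHom : IsVacuumHom α L (vacuumHom hL) where
  map_ι a := vacuumFun_eq hL (.ι hL a)
  map_S n hn := vacuumFun_eq hL (by
    have := ActsAs.monomial_of_ne (hL := hL) 1 hn.ne' 1
    simpa [monomial] using this)

end Existence

end Toeplitz

end VacuumStates

/-! ### Identity theorem, Phragmén–Lindelöf and three lines for entire functions -/

section ComplexAnalysis

variable {B : Type u} [NormedAddCommGroup B] [NormedSpace ℂ B]

/-- Two entire functions which agree on the real axis are equal. -/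
theorem Differentiable.eq_of_forall_ofReal [CompleteSpace B] {f g : ℂ → B} (hf : Differentiable ℂ f)
    (hg : Differentiable ℂ g) (h : ∀ t : ℝ, f t = g t) : f = g := by
  refine AnalyticOnNhd.eq_of_frequently_eq (z₀ := 0) (fun z _ => hf.analyticAt z)
    (fun z _ => hg.analyticAt z) ?_
  have ht : Filter.Tendsto (fun t : ℝ => (t : ℂ)) (nhdsWithin 0 {0}ᶜ) (nhdsWithin 0 {0}ᶜ) := by
    refine tendsto_nhdsWithin_of_tendsto_nhds_of_eventually_within _ ?_ ?_
    · exact (Complex.continuous_ofReal.tendsto' 0 0 Complex.ofReal_zero).mono_left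
        nhdsWithin_le_nhds
    · filter_upwards [self_mem_nhdsWithin] with t ht
      simpa using ht
  exact ht.frequently (Filter.Frequently.of_forall h)

/-- The Phragmén–Lindelöf principle for entire functions which are bounded on the upper half
plane. -/
theorem Differentiable.norm_le_of_bounded_of_upper_half_plane {G : ℂ → B}
    (hG : Differentiable ℂ G) {C D : ℝ} (hC : ∀ z : ℂ, 0 ≤ z.im → ‖G z‖ ≤ C)
    (hD : ∀ t : ℝ, ‖G t‖ ≤ D) {z : ℂ} (hz : 0 ≤ z.im) : ‖G z‖ ≤ D := by
  have hH : Differentiable ℂ fun w => G (Complex.I * w) :=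
    hG.comp (differentiable_id.const_mul _)
  have hb : ∀ w : ℂ, 0 ≤ w.re → ‖G (Complex.I * w)‖ ≤ C := fun w hw => hC _ (by simpa using hw)
  -- The rotation w ↦ iw carries the right half plane to the upper one. As G is bounded there, the
  -- growth condition holds with order 1 < 2 and constant 0.
  have h := PhragmenLindelof.right_half_plane_of_bounded_on_real (C := D) (z := -Complex.I * z)
    hH.diffContOnCl ⟨1, by norm_num, 0, ?_⟩ ?_ (fun t => ?_) (by simpa using hz)
  · simpa [← mul_assoc] using h
  · refine Asymptotics.IsBigO.of_bound C ?_
    refine Filter.eventually_inf_principal.2 (.of_forall fun w hw => ?_)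
    simpa using hb w (le_of_lt hw)
  · refine Filter.isBoundedUnder_of_eventually_le (a := C) ?_
    filter_upwards [Filter.eventually_ge_atTop 0] with t ht
    exact hb t (by simpa using ht)
  · have : Complex.I * (t * Complex.I) = ((-t : ℝ) : ℂ) := by
      rw [mul_left_comm, Complex.I_mul_I]; simp
    rw [this]
    exact hD _

/-- Hadamard's three lines theorem for entire functions on a horizontal strip. -/
theorem Differentiable.norm_le_interp_of_horizontal_strip {G : ℂ → B}
    (hG : Differentiable ℂ G) {R a M : ℝ} (hR : 0 < R)
    (hM : ∀ z : ℂ, 0 ≤ z.im → z.im ≤ R → ‖G z‖ ≤ M) (ha : ∀ t : ℝ, ‖G t‖ ≤ a) {z : ℂ}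
    (hz : 0 ≤ z.im) (hzR : z.im ≤ R) :
    ‖G z‖ ≤ a ^ (1 - z.im / R) * M ^ (z.im / R) := by
  have hH : Differentiable ℂ fun w => G (Complex.I * w) :=
    hG.comp (differentiable_id.const_mul _)
  have h := Complex.HadamardThreeLines.norm_le_interp_of_mem_verticalClosedStrip'
    (f := fun w => G (Complex.I * w)) (z := -Complex.I * z) (a := a) (b := M) hR
    (by simpa [Complex.HadamardThreeLines.verticalClosedStrip] using ⟨hz, hzR⟩)
    hH.diffContOnCl ?_ ?_ ?_
  · simpa [← mul_assoc] using h
  · refine ⟨M, ?_⟩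
    rintro _ ⟨w, hw, rfl⟩
    have hw' : 0 ≤ w.re ∧ w.re ≤ R := hw
    exact hM _ (by simpa using hw'.1) (by simpa using hw'.2)
  · intro w hw
    have hw' : w.re = 0 := hw
    have : Complex.I * w = ((-w.im : ℝ) : ℂ) := Complex.ext (by simp) (by simp [hw'])
    rw [this]
    exact ha _
  · intro w hw
    have hw' : w.re = R := hw
    exact hM _ (by simp [hw', hR.le]) (by simp [hw'])

end ComplexAnalysis

/-! ### Entire orbits and the reduction to a dense set -/

section EntireOrbits

variable {B : Type u} [CStarAlgebra B] {σ : ℝ → B →⋆ₐ[ℂ] B}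

namespace IsEntireOrbit

variable {x y : B} {f g : ℂ → B}

theorem add (hx : IsEntireOrbit σ x f) (hy : IsEntireOrbit σ y g) :
    IsEntireOrbit σ (x + y) fun z => f z + g z where
  differentiable := hx.differentiable.add hy.differentiable
  apply_ofReal t := by rw [hx.apply_ofReal, hy.apply_ofReal, map_add]

theorem smul (r : ℂ) (hx : IsEntireOrbit σ x f) : IsEntireOrbit σ (r • x) fun z => r • f z where
  differentiable := hx.differentiable.const_smul r
  apply_ofReal t := by rw [hx.apply_ofReal, map_smul]

theorem mul (hx : IsEntireOrbit σ x f) (hy : IsEntireOrbit σ y g) :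
    IsEntireOrbit σ (x * y) fun z => f z * g z where
  differentiable := hx.differentiable.mul hy.differentiable
  apply_ofReal t := by rw [hx.apply_ofReal, hy.apply_ofReal, map_mul]

theorem one : IsEntireOrbit σ 1 fun _ => 1 where
  differentiable := differentiable_const _
  apply_ofReal _ := (map_one _).symm

theorem zero : IsEntireOrbit σ 0 fun _ => 0 where
  differentiable := differentiable_const _
  apply_ofReal _ := (map_zero _).symm

theorem pow (hx : IsEntireOrbit σ x f) (n : ℕ) : IsEntireOrbit σ (x ^ n) fun z => f z ^ n := by
  induction n with
  | zero => simpa only [pow_zero] using one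
  | succ n ih => simpa only [pow_succ] using ih.mul hx

/-- An entire orbit is bounded on horizontal strips. -/
theorem exists_norm_le_of_strip (hσ : ∀ s t x, σ s (σ t x) = σ (s + t) x)
    (hx : IsEntireOrbit σ x f) (R : ℝ) :
    ∃ M, ∀ z : ℂ, 0 ≤ z.im → z.im ≤ R → ‖f z‖ ≤ M := by
  -- Both sides are entire in z and agree for real z. Since σ_t is contractive, a bound on the
  -- segment from 0 to iR then serves the whole strip.
  have hcov : ∀ (t : ℝ) (z : ℂ), f (t + z) = σ t (f z) := fun t => by
    refine congrFun (Differentiable.eq_of_forall_ofReal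
      (hx.differentiable.comp (differentiable_id.const_add _)) ?_ fun s => ?_)
    · let g : B →L[ℂ] B := ⟨(σ t).toAlgHom.toLinearMap, starAlgHom_continuous (σ t)⟩
      exact g.differentiable.comp hx.differentiable
    · rw [← Complex.ofReal_add, hx.apply_ofReal, hx.apply_ofReal, hσ]
  obtain ⟨M, hM⟩ := isCompact_Icc.exists_bound_of_continuousOn (s := Set.Icc 0 R)
    (f := fun s : ℝ => f (s * Complex.I))
    (hx.differentiable.continuous.comp (by fun_prop)).continuousOn
  refine ⟨M, fun z h0 hR => ?_⟩
  rw [← Complex.re_add_im z, hcov]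
  exact (NonUnitalStarAlgHom.norm_apply_le _ _).trans (hM _ ⟨h0, hR⟩)

end IsEntireOrbit

theorem IsState.differentiable_apply_mul {ψ : B →ₗ[ℂ] ℂ} (hψ : IsState ψ) (x : B) {f : ℂ → B}
    (hf : Differentiable ℂ f) : Differentiable ℂ fun z => ψ (x * f z) :=
  (⟨ψ, hψ.continuous⟩ : B →L[ℂ] ℂ).differentiable.comp (hf.const_mul x)

theorem IsState.norm_apply_mul_le {ψ : B →ₗ[ℂ] ℂ} (hψ : IsState ψ) (x y : B) :
    ‖ψ (x * y)‖ ≤ ‖x‖ * ‖y‖ :=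
  (hψ.norm_apply_le _).trans (norm_mul_le _ _)

/-- If the boundedness condition of ground states holds for the orbits of a dense set of elements,
then it holds for all analytic elements. -/
theorem IsState.exists_bound_of_dense {ψ : B →ₗ[ℂ] ℂ} (hψ : IsState ψ)
    (hσ : ∀ s t x, σ s (σ t x) = σ (s + t) x) {D : Set B} (hD : Dense D) (x : B)
    (h : ∀ w ∈ D, ∃ g, IsEntireOrbit σ w g ∧ ∃ C, ∀ z : ℂ, 0 ≤ z.im → ‖ψ (x * g z)‖ ≤ C)
    {y : B} {f : ℂ → B} (hf : IsEntireOrbit σ y f) :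
    ∃ K : ℝ, ∀ z : ℂ, 0 ≤ z.im → ‖ψ (x * f z)‖ ≤ K := by
  -- The first summand bounds the orbit of any approximant w with ‖w‖ ≤ ‖y‖ + 1; the final 1 absorbs
  -- the error at z. The approximant may depend on z, because the bound does not.
  refine ⟨‖x‖ * (‖y‖ + 1) + 1, fun z hz => ?_⟩
  obtain ⟨M, hM⟩ := hf.exists_norm_le_of_strip hσ (z.im + 1)
  set C := ‖x‖ * M + ‖x‖ * (‖y‖ + 1)
  -- In a strip of height Im z + 1 the point z lies below the top edge, so the bound on the real
  -- axis enters with exponent p > 0. As C does not depend on w, a close enough w makes the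
  -- interpolated error less than 1.
  set p := 1 - z.im / (z.im + 1) with hp
  have hp0 : 0 < p := by
    rw [hp, sub_pos, div_lt_one (by positivity)]
    exact lt_add_one _
  have hlim : Filter.Tendsto (fun δ : ℝ => (‖x‖ * δ) ^ p * C ^ (z.im / (z.im + 1)))
      (nhds 0) (nhds 0) := by
    have h1 : ContinuousAt (fun δ : ℝ => (‖x‖ * δ) ^ p * C ^ (z.im / (z.im + 1))) 0 :=
      (ContinuousAt.rpow_const (by fun_prop) (Or.inr hp0.le)).mul continuousAt_const
    simpa [ContinuousAt, Real.zero_rpow hp0.ne'] using h1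
  obtain ⟨ε, hε, hball⟩ := Metric.eventually_nhds_iff.1 (hlim.eventually_lt_const one_pos)
  obtain ⟨w, hw, hyw⟩ := Metric.dense_iff.1 hD y (min (ε / 2) 1) (by positivity)
  rw [Metric.mem_ball, dist_eq_norm] at hw
  obtain ⟨g, hg, Cw, hCw⟩ := h w hyw
  have hwε : ‖w - y‖ ≤ ε / 2 := hw.le.trans (min_le_left _ _)
  have hwn : ‖w‖ ≤ ‖y‖ + 1 := by
    have := norm_add_le (w - y) y
    rw [sub_add_cancel] at this
    linarith [hw.le.trans (min_le_right _ _)]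
  -- The uncontrolled bound `Cw` only licenses Phragmén–Lindelöf, which replaces it by the bound on
  -- the real axis.
  have hgb : ∀ z : ℂ, 0 ≤ z.im → ‖ψ (x * g z)‖ ≤ ‖x‖ * (‖y‖ + 1) := fun z hz =>
    (hψ.differentiable_apply_mul x hg.differentiable).norm_le_of_bounded_of_upper_half_plane
      hCw (fun t => by
        refine (hψ.norm_apply_mul_le _ _).trans ?_
        rw [hg.apply_ofReal]
        gcongr
        exact (NonUnitalStarAlgHom.norm_apply_le _ _).trans hwn) hz
  have hdiff := (hψ.differentiable_apply_mul x
    (hf.differentiable.sub hg.differentiable)).norm_le_interp_of_horizontal_strip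
    (R := z.im + 1) (a := ‖x‖ * (ε / 2)) (M := C) (by positivity) (fun v hv0 hv => by
      simp only [Pi.sub_apply, mul_sub, map_sub]
      refine (norm_sub_le _ _).trans (add_le_add ((hψ.norm_apply_mul_le _ _).trans ?_) (hgb v hv0))
      gcongr
      exact hM v hv0 hv) (fun t => by
      refine (hψ.norm_apply_mul_le _ _).trans ?_
      gcongr
      rw [Pi.sub_apply, hf.apply_ofReal, hg.apply_ofReal, ← map_sub, ← norm_neg, ← map_neg, neg_sub]
      exact (NonUnitalStarAlgHom.norm_apply_le _ _).trans hwε) hz (lt_add_one _).le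
  have hlt : (‖x‖ * (ε / 2)) ^ p * C ^ (z.im / (z.im + 1)) < 1 := hball (by
    rw [Real.dist_0_eq_abs, abs_of_pos (by positivity)]
    linarith)
  have hsum : ψ (x * f z) = ψ (x * g z) + ψ (x * (f - g) z) := by
    simp only [Pi.sub_apply, mul_sub, map_sub]
    ring
  rw [hsum]
  exact (norm_add_le _ _).trans (add_le_add (hgb z hz) (hdiff.trans hlt.le))

end EntireOrbits

/-! ### Complex powers of h -/

noncomputable section ComplexPowers

variable {A : Type u} [CStarAlgebra A]

/-- The power `h^{iz} = exp (i z log h)`, for complex `z`. -/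
def cipow (h : A) (z : ℂ) : A := NormedSpace.exp ((Complex.I * z) • CFC.log h)

theorem cipow_zero (h : A) : cipow h 0 = 1 := by simp [cipow]

theorem cipow_add (h : A) (z w : ℂ) : cipow h (z + w) = cipow h z * cipow h w := by
  let _ : NormedAlgebra ℚ A := .restrictScalars ℚ ℂ A
  have hcomm : Commute ((Complex.I * z) • CFC.log h) ((Complex.I * w) • CFC.log h) :=
    ((Commute.refl _).smul_left _).smul_right _
  rw [cipow, mul_add, add_smul, NormedSpace.exp_add_of_commute hcomm]
  rfl

theorem star_cipow_ofReal (h : A) (t : ℝ) : star (cipow h t) = cipow h ((-t : ℝ) : ℂ) := by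
  rw [cipow, NormedSpace.star_exp, star_smul, IsSelfAdjoint.log.star_eq, cipow]
  simp

theorem differentiable_cipow (h : A) : Differentiable ℂ (cipow h) := by
  have h1 : Differentiable ℂ fun z : ℂ => NormedSpace.exp (z • CFC.log h) := fun z =>
    (hasDerivAt_exp_smul_const (𝕂 := ℂ) (CFC.log h) z).differentiableAt
  exact h1.comp (differentiable_id.const_mul Complex.I)

/-- With z = s + ir, the power factors as h^{is} h^{-r}. The first factor is unitary; the second is
bounded by c^{-r} through functional calculus, because log is operator monotone and so log h ≥ log
c. -/
theorem norm_cipow_le [PartialOrder A] [StarOrderedRing A] {h : A} {c : ℝ} (hc : 0 < c)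
    (hch : algebraMap ℝ A c ≤ h) {z : ℂ} (hz : 0 ≤ z.im) :
    ‖cipow h z‖ ≤ Real.exp (-z.im * Real.log c) := by
  have hpos : IsStrictlyPositive (algebraMap ℝ A c) :=
    isStrictlyPositive_algebraMap hc
  have hlog : algebraMap ℝ A (Real.log c) ≤ CFC.log h := by
    rw [← CFC.log_algebraMap]
    exact CFC.log_le_log hch hpos
  have hsa : IsSelfAdjoint (CFC.log h) := IsSelfAdjoint.log
  have hspec : ∀ x ∈ spectrum ℝ (CFC.log h), Real.log c ≤ x :=
    (algebraMap_le_iff_le_spectrum).1 hlog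
  have hre : ‖cipow h (z.re : ℂ)‖ ≤ 1 :=
by
    nontriviality A
    exact (CStarRing.norm_of_mem_unitary (Toeplitz.ipow_mem_unitary h z.re)).le
  have him : cipow h (z.im * Complex.I) =
      cfc (fun x : ℝ => Real.exp (-z.im * x)) (CFC.log h) := by
    rw [cfc_comp_const_mul (-z.im) Real.exp (CFC.log h), CFC.real_exp_eq_normedSpace_exp, cipow]
    congr 1
    rw [← Complex.coe_smul]
    congr 1
    rw [mul_left_comm, Complex.I_mul_I]
    simp
  have hn : ‖cipow h (z.im * Complex.I)‖ ≤ Real.exp (-z.im * Real.log c) := by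
    rw [him]
    refine norm_cfc_le (Real.exp_pos _).le fun x hx => ?_
    rw [Real.norm_of_nonneg (Real.exp_pos _).le, Real.exp_le_exp]
    nlinarith [hspec x hx]
  calc ‖cipow h z‖ = ‖cipow h z.re * cipow h (z.im * Complex.I)‖ := by
        rw [← cipow_add, Complex.re_add_im]
    _ ≤ 1 * Real.exp (-z.im * Real.log c) := (norm_mul_le _ _).trans (by gcongr)
    _ = _ := one_mul _

end ComplexPowers

/-! ### Ground states are the vacuum states -/

noncomputable section GroundStates

namespace Toeplitz

variable {A : Type u} [CStarAlgebra A] (α : A →⋆ₐ[ℂ] A) (L : A → A) {h : A}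
  (hcen : h ∈ Set.center A)

theorem gauge_ι (t : ℝ) (a : A) : gauge α L hcen t (ι α L a) = ι α L a := sigma_ι ..

theorem gauge_S (t : ℝ) : gauge α L hcen t (S α L) = ι α L (cipow h t) * S α L := sigma_S ..

theorem gauge_star_S (t : ℝ) :
    gauge α L hcen t (star (S α L)) = star (S α L) * ι α L (cipow h (-t)) := by
  rw [map_star, gauge_S, star_mul, ← map_star, star_cipow_ofReal, Complex.ofReal_neg]

theorem gauge_gauge (s t : ℝ) (x : Toeplitz α L) :
    gauge α L hcen s (gauge α L hcen t x) = gauge α L hcen (s + t) x := by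
  have : (gauge α L hcen s).comp (gauge α L hcen t) = gauge α L hcen (s + t) := by
    refine hom_ext α L (fun a => ?_) ?_
    · rw [StarAlgHom.comp_apply, gauge_ι, gauge_ι, gauge_ι]
    · rw [StarAlgHom.comp_apply, gauge_S, map_mul, gauge_ι, gauge_S, gauge_S, ← mul_assoc,
        ← map_mul, ← cipow_add, Complex.ofReal_add, add_comm (s : ℂ)]
  exact congrArg (fun f => f x) this

theorem differentiable_ι_comp {f : ℂ → A} (hf : Differentiable ℂ f) :
    Differentiable ℂ fun z => ι α L (f z) :=
  (⟨(ι α L).toAlgHom.toLinearMap, starAlgHom_continuous _⟩ :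
    A →L[ℂ] Toeplitz α L).differentiable.comp hf

theorem isEntireOrbit_ι (a : A) : IsEntireOrbit (gauge α L hcen) (ι α L a) fun _ => ι α L a where
  differentiable := differentiable_const _
  apply_ofReal t := (gauge_ι α L hcen t a).symm

theorem isEntireOrbit_S :
    IsEntireOrbit (gauge α L hcen) (S α L) fun z => ι α L (cipow h z) * S α L where
  differentiable := (differentiable_ι_comp α L (differentiable_cipow h)).mul_const _
  apply_ofReal t := (gauge_S α L hcen t).symm

theorem isEntireOrbit_star_S :
    IsEntireOrbit (gauge α L hcen) (star (S α L)) fun z => star (S α L) * ι α L (cipow h (-z)) where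
  differentiable :=
    (differentiable_ι_comp α L ((differentiable_cipow h).comp differentiable_neg)).const_mul _
  apply_ofReal t := (gauge_star_S α L hcen t).symm

theorem isEntireOrbit_monomial (a : A) (n m : ℕ) (b : A) :
    IsEntireOrbit (gauge α L hcen) (monomial α L a n m b) fun z =>
      ι α L a * (ι α L (cipow h z) * S α L) ^ n * (star (S α L) * ι α L (cipow h (-z))) ^ m *
        ι α L b :=
  (((isEntireOrbit_ι α L hcen a).mul ((isEntireOrbit_S α L hcen).pow n)).mul
    ((isEntireOrbit_star_S α L hcen).pow m)).mul (isEntireOrbit_ι α L hcen b)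

variable [PartialOrder A] [StarOrderedRing A] {c : ℝ} {α L}

/-- Ground states are vacuum states. -/
theorem isVacuumState_of_isGroundState (hc : 1 < c) (hch : algebraMap ℝ A c ≤ h)
    {ψ : Toeplitz α L →ₗ[ℂ] ℂ} (hψ : IsGroundState (gauge α L hcen) ψ) : IsVacuumState α L ψ where
  isState := hψ.isState
  apply_eq_zero b := by
    set x := star (star (S α L) * ι α L b) with hx_def
    have hx : IsAnalyticElement (gauge α L hcen) x := by
      rw [hx_def, star_mul, star_star, ← map_star]
      exact ⟨_, (isEntireOrbit_ι α L hcen _).mul (isEntireOrbit_S α L hcen)⟩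
    have hf := (isEntireOrbit_star_S α L hcen).mul (isEntireOrbit_ι α L hcen b)
    set f := fun z => star (S α L) * ι α L (cipow h (-z)) * ι α L b with hf_def
    obtain ⟨K, hK⟩ := hψ.bounded x _ hx f hf
    set M := ‖x‖ * (‖star (S α L)‖ * ‖ι α L b‖)
    -- The ground state condition covers the upper half plane. In the lower one the factor h^{-iz}
    -- gives decay, as -z lies in the upper half plane.
    have hlow : ∀ z : ℂ, z.im ≤ 0 → ‖ψ (x * f z)‖ ≤ M * Real.exp (z.im * Real.log c) := by
      intro z hz
      have h1 : ‖ι α L (cipow h (-z))‖ ≤ Real.exp (z.im * Real.log c) := by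
        refine (NonUnitalStarAlgHom.norm_apply_le _ _).trans ?_
        have := norm_cipow_le (zero_lt_one.trans hc) hch (z := -z) (by simpa using hz)
        simpa using this
      calc ‖ψ (x * f z)‖ ≤ ‖x‖ * ‖f z‖ := hψ.isState.norm_apply_mul_le _ _
        _ ≤ ‖x‖ * (‖star (S α L)‖ * Real.exp (z.im * Real.log c) * ‖ι α L b‖) := by
          gcongr
          refine (norm_mul_le _ _).trans ?_
          gcongr
          refine (norm_mul_le _ _).trans ?_
          gcongr
        _ = _ := by ring
    have hlogc : 0 < Real.log c := Real.log_pos hc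
    have hM : 0 ≤ M := by positivity
    have hbdd : Bornology.IsBounded (Set.range fun z => ψ (x * f z)) := by
      refine isBounded_iff_forall_norm_le.2 ⟨max K M, ?_⟩
      rintro _ ⟨z, rfl⟩
      rcases le_total 0 z.im with hz | hz
      · exact (hK z hz).trans (le_max_left _ _)
      · refine (hlow z hz).trans ((mul_le_of_le_one_right hM ?_).trans (le_max_right _ _))
        exact Real.exp_le_one_iff.2 (mul_nonpos_of_nonpos_of_nonneg hz hlogc.le)
    -- Liouville: the function is constant, and the decay along -is forces its value at 0, the
    -- quantity sought, to vanish.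
    have hconst := (hψ.isState.differentiable_apply_mul x
      hf.differentiable).apply_eq_apply_of_bounded hbdd 0
    have hle : ∀ s : ℝ, 0 ≤ s → ‖ψ (x * f 0)‖ ≤ M * Real.exp (-s * Real.log c) := fun s hs => by
      have := hlow (-(s * Complex.I)) (by simpa using hs)
      rw [hconst (-(s * Complex.I))]
      simpa using this
    have hlim : Filter.Tendsto (fun s : ℝ => M * Real.exp (-s * Real.log c)) Filter.atTop
        (nhds 0) := by
      have := (Real.tendsto_exp_atBot.comp
        (Filter.tendsto_neg_atTop_atBot.atBot_mul_const hlogc)).const_mul M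
      rwa [mul_zero] at this
    have hzero : ‖ψ (x * f 0)‖ ≤ 0 := ge_of_tendsto hlim (by
      filter_upwards [Filter.eventually_ge_atTop 0] with s hs using hle s hs)
    have hf0 : f 0 = star (S α L) * ι α L b := by simp [hf_def, cipow_zero]
    rw [hf0] at hzero
    exact norm_le_zero_iff.1 hzero

/-- If m > 0, the orbit of a monomial ends in Ŝ* times an element of A, so ψ gives 0 for every z. If
m = 0, only factors h^{iz} occur, of norm at most 1 for Im z ≥ 0. -/
theorem IsVacuumState.exists_bound_of_mem_monomialSpan {ψ : Toeplitz α L →ₗ[ℂ] ℂ}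
    (hψ : IsVacuumState α L ψ) (hc : 1 < c) (hch : algebraMap ℝ A c ≤ h) (x : Toeplitz α L)
    {w : Toeplitz α L} (hw : w ∈ monomialSpan α L) :
    ∃ g, IsEntireOrbit (gauge α L hcen) w g ∧ ∃ C, ∀ z : ℂ, 0 ≤ z.im → ‖ψ (x * g z)‖ ≤ C := by
  refine Submodule.span_induction (p := fun w _ => ∃ g, IsEntireOrbit (gauge α L hcen) w g ∧
    ∃ C, ∀ z : ℂ, 0 ≤ z.im → ‖ψ (x * g z)‖ ≤ C) ?_ ?_ ?_ ?_ hw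
  · rintro _ ⟨a, n, m, b, rfl⟩
    refine ⟨_, isEntireOrbit_monomial α L hcen a n m b, ?_⟩
    by_cases hm : m = 0
    · subst hm
      refine ⟨‖x‖ * (‖ι α L a‖ * ‖S α L‖ ^ n * ‖ι α L b‖), fun z hz => ?_⟩
      refine (hψ.isState.norm_apply_mul_le _ _).trans ?_
      have h1 : ‖ι α L (cipow h z)‖ ≤ 1 := by
        refine (NonUnitalStarAlgHom.norm_apply_le _ _).trans
          ((norm_cipow_le (zero_lt_one.trans hc) hch hz).trans (Real.exp_le_one_iff.2 ?_))
        have := Real.log_pos hc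
        nlinarith
      have h2 : ∀ k : ℕ, ‖ι α L a * (ι α L (cipow h z) * S α L) ^ k‖ ≤
          ‖ι α L a‖ * ‖S α L‖ ^ k := fun k => by
        induction k with
        | zero => simp
        | succ k ih =>
          rw [pow_succ, ← mul_assoc, pow_succ, ← mul_assoc ‖ι α L a‖]
          refine (norm_mul_le _ _).trans (mul_le_mul ih ?_ (norm_nonneg _) (by positivity))
          exact (norm_mul_le _ _).trans (mul_le_of_le_one_left (norm_nonneg _) h1)
      rw [pow_zero, mul_one]
      gcongr
      refine (norm_mul_le _ _).trans ?_
      gcongr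
      exact h2 n
    · obtain ⟨j, rfl⟩ := Nat.exists_eq_succ_of_ne_zero hm
      refine ⟨0, fun z _ => ?_⟩
      have h1 : x * (ι α L a * (ι α L (cipow h z) * S α L) ^ n *
          (star (S α L) * ι α L (cipow h (-z))) ^ (j + 1) * ι α L b) =
          (x * (ι α L a * (ι α L (cipow h z) * S α L) ^ n *
          (star (S α L) * ι α L (cipow h (-z))) ^ j)) *
          (star (S α L) * ι α L (cipow h (-z) * b)) := by
        rw [pow_succ, map_mul]
        simp only [mul_assoc]
      rw [Nat.succ_eq_add_one, h1, hψ.apply_mul_star_S_mul, norm_zero]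
  · exact ⟨_, .zero, 0, fun z _ => by simp⟩
  · rintro w₁ w₂ _ _ ⟨g₁, h₁, C₁, hC₁⟩ ⟨g₂, h₂, C₂, hC₂⟩
    refine ⟨_, h₁.add h₂, C₁ + C₂, fun z hz => ?_⟩
    rw [mul_add, map_add]
    exact (norm_add_le _ _).trans (add_le_add (hC₁ z hz) (hC₂ z hz))
  · rintro r w _ ⟨g, hg, C, hC⟩
    refine ⟨_, hg.smul r, ‖r‖ * C, fun z hz => ?_⟩
    rw [mul_smul_comm, map_smul, norm_smul]
    gcongr
    exact hC z hz

/-- The ground states are precisely the vacuum states. -/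
theorem isGroundState_iff_isVacuumState (hc : 1 < c) (hch : algebraMap ℝ A c ≤ h)
    {ψ : Toeplitz α L →ₗ[ℂ] ℂ} : IsGroundState (gauge α L hcen) ψ ↔ IsVacuumState α L ψ :=
  ⟨isVacuumState_of_isGroundState hcen hc hch, fun hψ => ⟨hψ.isState, fun x _ _ _ hf =>
    hψ.isState.exists_bound_of_dense (gauge_gauge α L hcen) (mem_closure_monomialSpan α L) x
      (fun _ hw => hψ.exists_bound_of_mem_monomialSpan hcen hc hch x hw) hf⟩⟩

end Toeplitz

theorem IsState.comp_starAlgHom {B : Type u} {C : Type v} [CStarAlgebra B] [CStarAlgebra C]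
    {ψ : C →ₗ[ℂ] ℂ} (hψ : IsState ψ) (g : B →⋆ₐ[ℂ] C) :
    IsState (ψ ∘ₗ g.toAlgHom.toLinearMap) where
  nonneg x := by
    obtain ⟨r, hr, h⟩ := hψ.nonneg (g x)
    refine ⟨r, hr, ?_⟩
    change ψ (g (star x * x)) = r
    rw [map_mul, StarHomClass.map_star, h]
  map_one := by
    change ψ (g 1) = 1
    rw [_root_.map_one, hψ.map_one]

end GroundStates

theorem proposition10p4 {A : Type u} [CStarAlgebra A] [PartialOrder A] [StarOrderedRing A]
    (α : A →⋆ₐ[ℂ] A) (hα : Function.Injective α)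
    (E : A → A) (hE : IsConditionalExpectation α.range E)
    (h : A) (hsa : IsSelfAdjoint h) (hcen : h ∈ Set.center A)
    (c : ℝ) (hc : 1 < c) (hch : algebraMap ℝ A c ≤ h) :
    IsConditionalExpectation (Toeplitz.fixed α (transferOperator α E))
        (Toeplitz.circleMean α (transferOperator α E)) ∧
    (∃! π : Toeplitz.fixed α (transferOperator α E) →⋆ₐ[ℂ] A,
        Toeplitz.IsVacuumHom α (transferOperator α E) π) ∧
    ∀ π : Toeplitz.fixed α (transferOperator α E) →⋆ₐ[ℂ] A,
      Toeplitz.IsVacuumHom α (transferOperator α E) π →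
      ∀ ψ : Toeplitz α (transferOperator α E) →ₗ[ℂ] ℂ,
        IsGroundState (Toeplitz.gauge α (transferOperator α E) hcen) ψ ↔
          ∃ φ : A →ₗ[ℂ] ℂ, IsState φ ∧
            ∀ x, ψ x = φ (π (Toeplitz.expectation α (transferOperator α E) x)) := by
  have hL := isTransferOperator_transferOperator hα hE
  refine ⟨Toeplitz.isConditionalExpectation_circleMean .., ?_, fun π hπ ψ => ?_⟩
  · exact ⟨Toeplitz.vacuumHom hL, Toeplitz.isVacuumHom_vacuumHom hL,
      fun π hπ => hπ.unique (Toeplitz.isVacuumHom_vacuumHom hL)⟩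
  · rw [Toeplitz.isGroundState_iff_isVacuumState hcen hc hch]
    constructor
    · intro hψ
      have hφ := hψ.isState.comp_starAlgHom (Toeplitz.ι α (transferOperator α E))
      -- Here φ is the restriction of ψ to A, and two vacuum states that agree on A coincide.
      refine ⟨_, hφ, fun x => LinearMap.congr_fun (hψ.ext (hπ.isVacuumState hφ) fun a => ?_) x⟩
      change ψ (Toeplitz.ι _ _ a) =
        ψ (Toeplitz.ι _ _ (π (Toeplitz.expectation _ _ (Toeplitz.ι _ _ a))))
      rw [hπ.expectation_ι]
    · rintro ⟨φ, hφ, h⟩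
      have hψ : ψ = φ ∘ₗ π.toAlgHom.toLinearMap ∘ₗ Toeplitz.expectationLinear _ _ :=
        LinearMap.ext h
      exact hψ ▸ hπ.isVacuumState hφ
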